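/- Let $(M,g)$ be a smooth 4-dimensional Riemannian manifold with Levi-Civita connection $\nabla$ and curvature tensor $R(X,Y)Z=[\nabla_X,\nabla_Y]Z-\nabla_{[X,Y]}Z$. Call $(M,g)$ \emph{weakly Einstein} if $$R^{abc}{}_{i}\,R_{abcj}=\tfrac14\,|R|^2\,g_{ij}$$ holds at every point of $M$, where $|R|^2=R^{abcd}R_{abcd}$ is not required to be constant. For $p\in M$ and an orthonormal basis $\{e_1,e_2,e_3,e_4\}$ of $T_pM$, write $R_{ijkl}=g(R(e_i,e_j)e_k,e_l)$; the basis is called a \emph{generalized Singer–Thorpe basis} of $T_pM$ if $$R_{ijjk}=0\quad\text{for all } 1\le i,j,k\le 4 \text{ with } i\neq k,$$ $$R_{1212}^2=R_{3434}^2,\qquad R_{1313}^2=R_{2424}^2,\qquad R_{1414}^2=R_{2323}^2 .$$ Then $(M,g)$ is weakly Einstein if and only if, at each point $p\in M$, there exists a generalized Singer–Thorpe basis of $T_pM$. -/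

import Mathlib

open scoped Manifold ContDiff

noncomputable section

namespace RiemannianCurvature

/-! A smooth `n`-manifold is modelled on `EuclideanSpace ℝ (Fin n)` (no boundary), and its Riemannian
metric is a smooth section `g` of positive definite symmetric bilinear forms on the tangent spaces.
The Levi-Civita connection and the curvature tensor at a point `p` are computed in the local
coordinates of the chart at `p`; since curvature is a tensor, its values on tangent vectors at `p`
do not depend on the chart. -/

/-- Smooth Riemannian metrics on the smooth `n`-manifold `M`. -/
abbrev Metric (n : ℕ) (M : Type*) [TopologicalSpace M] [ChartedSpace (EuclideanSpace ℝ (Fin n)) M]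
    [IsManifold (𝓡 n) ∞ M] : Type _ :=
  Bundle.ContMDiffRiemannianMetric (𝓡 n) ∞ (EuclideanSpace ℝ (Fin n))
    (fun x : M => TangentSpace (𝓡 n) x)

/-- The partial derivative `∂ᵢ f` at `y` of a function of `n` real variables. -/
def partialDeriv {n : ℕ} (i : Fin n) (f : EuclideanSpace ℝ (Fin n) → ℝ)
    (y : EuclideanSpace ℝ (Fin n)) : ℝ :=
  fderiv ℝ f y (EuclideanSpace.single i 1)

variable {n : ℕ} {M : Type*} [TopologicalSpace M] [ChartedSpace (EuclideanSpace ℝ (Fin n)) M]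

/-- The coordinate vector `∂ᵢ` of the chart at `p`, at the point with coordinates `y`. -/
def coordVector (p : M) (y : EuclideanSpace ℝ (Fin n)) (i : Fin n) :
    TangentSpace (𝓡 n) ((extChartAt (𝓡 n) p).symm y) :=
  mfderiv 𝓘(ℝ, EuclideanSpace ℝ (Fin n)) (𝓡 n) (extChartAt (𝓡 n) p).symm y
    (EuclideanSpace.single i (1 : ℝ) : EuclideanSpace ℝ (Fin n))

/-- The component `dxⁱ(u)` of `u ∈ T_p M` in the coordinates of the chart at `p`. -/
def component {p : M} (u : TangentSpace (𝓡 n) p) (i : Fin n) : ℝ :=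
  mvfderiv (𝓡 n) (extChartAt (𝓡 n) p) p u i

variable [IsManifold (𝓡 n) ∞ M]

/-- The matrix `(gᵢⱼ)` of the metric in the chart at `p`, at the point with coordinates `y`. -/
def metricMatrix (g : Metric n M) (p : M) (y : EuclideanSpace ℝ (Fin n)) :
    Matrix (Fin n) (Fin n) ℝ :=
  Matrix.of fun i j =>
    g.inner ((extChartAt (𝓡 n) p).symm y) (coordVector p y i) (coordVector p y j)

/-- The Christoffel symbol `Γᵏᵢⱼ` of the Levi-Civita connection, `∇_{∂ᵢ} ∂ⱼ = ∑ₖ Γᵏᵢⱼ ∂ₖ`,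
in the chart at `p`, at the point with coordinates `y`. -/
def christoffel (g : Metric n M) (p : M) (k i j : Fin n) (y : EuclideanSpace ℝ (Fin n)) : ℝ :=
  (1 / 2) * ∑ l, (metricMatrix g p y)⁻¹ k l *
    (partialDeriv i (fun z => metricMatrix g p z j l) y
      + partialDeriv j (fun z => metricMatrix g p z i l) y
      - partialDeriv l (fun z => metricMatrix g p z i j) y)

/-- The component `Rᵢⱼₖˡ` at `p` of the curvature tensor in the chart at `p`:
`R(∂ᵢ, ∂ⱼ)∂ₖ = ∑ₗ Rᵢⱼₖˡ ∂ₗ`, where `R(X, Y)Z = ∇_X ∇_Y Z - ∇_Y ∇_X Z - ∇_[X, Y] Z`. -/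
def curvatureUp (g : Metric n M) (p : M) (i j k l : Fin n) : ℝ :=
  partialDeriv i (christoffel g p l j k) (extChartAt (𝓡 n) p p)
    - partialDeriv j (christoffel g p l i k) (extChartAt (𝓡 n) p p)
    + ∑ m, (christoffel g p m j k (extChartAt (𝓡 n) p p)
              * christoffel g p l i m (extChartAt (𝓡 n) p p)
          - christoffel g p m i k (extChartAt (𝓡 n) p p)
              * christoffel g p l j m (extChartAt (𝓡 n) p p))

/-- The component `Rᵢⱼₖₗ = g(R(∂ᵢ, ∂ⱼ)∂ₖ, ∂ₗ)` at `p` in the chart at `p`. -/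
def curvatureCoord (g : Metric n M) (p : M) (i j k l : Fin n) : ℝ :=
  ∑ m, curvatureUp g p i j k m * metricMatrix g p (extChartAt (𝓡 n) p p) m l

/-- The curvature tensor `R(u, v, w, z) = g(R(u, v)w, z)` on tangent vectors at `p`. -/
def curvature (g : Metric n M) (p : M) (u v w z : TangentSpace (𝓡 n) p) : ℝ :=
  ∑ i, ∑ j, ∑ k, ∑ l, curvatureCoord g p i j k l
    * component u i * component v j * component w k * component z l

/-- `R^{abc}ᵢ` at `p` in the chart at `p`: the first three indices are raised by the inverse
metric. -/
def curvatureRaised (g : Metric n M) (p : M) (a b c i : Fin n) : ℝ :=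
  ∑ a', ∑ b', ∑ c', (metricMatrix g p (extChartAt (𝓡 n) p p))⁻¹ a a'
    * (metricMatrix g p (extChartAt (𝓡 n) p p))⁻¹ b b'
    * (metricMatrix g p (extChartAt (𝓡 n) p p))⁻¹ c c' * curvatureCoord g p a' b' c' i

/-- `Řᵢⱼ = R^{abc}ᵢ R_{abcj}` at `p` in the chart at `p`. -/
def curvatureSquare (g : Metric n M) (p : M) (i j : Fin n) : ℝ :=
  ∑ a, ∑ b, ∑ c, curvatureRaised g p a b c i * curvatureCoord g p a b c j

/-- `|R|² = R^{abcd} R_{abcd}` at `p`. -/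
def curvatureNormSq (g : Metric n M) (p : M) : ℝ :=
  ∑ i, ∑ j, (metricMatrix g p (extChartAt (𝓡 n) p p))⁻¹ i j * curvatureSquare g p i j

end RiemannianCurvature

open RiemannianCurvature in
/-- A Riemannian 4-manifold is weakly Einstein if `R^{abc}ᵢ R_{abcj} = (1/4) |R|² gᵢⱼ` at every
point. -/
def IsWeaklyEinstein {M : Type*} [TopologicalSpace M]
    [ChartedSpace (EuclideanSpace ℝ (Fin 4)) M] [IsManifold (𝓡 4) ∞ M] (g : Metric 4 M) : Prop :=
  ∀ (p : M) (i j : Fin 4),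
    curvatureSquare g p i j =
      (1 / 4) * curvatureNormSq g p * metricMatrix g p (extChartAt (𝓡 4) p p) i j

open RiemannianCurvature in
/-- A generalized Singer-Thorpe basis of `T_p M`. The vectors `e₁, e₂, e₃, e₄` are
`e 0, e 1, e 2, e 3`. -/
structure IsGeneralizedSingerThorpeBasis {M : Type*} [TopologicalSpace M]
    [ChartedSpace (EuclideanSpace ℝ (Fin 4)) M] [IsManifold (𝓡 4) ∞ M] (g : Metric 4 M) (p : M)
    (e : Module.Basis (Fin 4) ℝ (TangentSpace (𝓡 4) p)) : Prop where
  orthonormal : ∀ i j, g.inner p (e i) (e j) = if i = j then 1 else 0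
  offDiagonal : ∀ i j k, i ≠ k → curvature g p (e i) (e j) (e j) (e k) = 0
  sq_12_34 : curvature g p (e 0) (e 1) (e 0) (e 1) ^ 2 = curvature g p (e 2) (e 3) (e 2) (e 3) ^ 2
  sq_13_24 : curvature g p (e 0) (e 2) (e 0) (e 2) ^ 2 = curvature g p (e 1) (e 3) (e 1) (e 3) ^ 2
  sq_14_23 : curvature g p (e 0) (e 3) (e 0) (e 3) ^ 2 = curvature g p (e 1) (e 2) (e 1) (e 2) ^ 2

end

/-! In an orthonormal frame at a point, view the curvature tensor as a symmetric operator on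
bivectors. In the splitting into self-dual and anti-self-dual bivectors it has symmetric 3×3
diagonal blocks `A`, `C` and an off-diagonal block `Z`. The trace-free part of `Řᵢⱼ` has nine
components, and they encode the nine entries of `A Z + Z C`; so weakly Einstein gives `A Z = -(Z C)`
(`curvatureBlock_anticommute`).

Since `Z` intertwines the symmetric matrices `A` and `-C`, a simultaneous singular value
decomposition (`exists_orthonormal_singular_bases`) gives orthonormal triples `p`, `q` in which all
three blocks are diagonal and `(aᵢ + cᵢ) zᵢ = 0`. After sign changes both triples are right-handed,
and the double cover of SO(4) by pairs of unit quaternions realizes them by one orthonormal frame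
(`exists_orthogonal_conj`). In that frame, let `x` and `y` be the components `R` takes on a
coordinate plane and on its complement: then `aᵢ + cᵢ = 2(x + y)` and `zᵢ = x - y`, so `x² = y²`,
while diagonality of the blocks kills every `R_{ijjk}` with `i ≠ k`.

The converse is a direct computation of `Řᵢⱼ`. The remaining work derives the curvature symmetries
from the Christoffel formula and translates between chart components and frames. -/

noncomputable section

/-! ### The metric in a chart: values at the base point, smoothness, positivity. -/

namespace RiemannianCurvature
section Chart
variable {n : ℕ} {M : Type*} [TopologicalSpace M] [ChartedSpace (EuclideanSpace ℝ (Fin n)) M]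
  [IsManifold (𝓡 n) ∞ M]

/-- The tangent space at `p` is identified with the model space through the chart at `p` itself, so
that chart has identity derivative there. -/
theorem component_eq {p : M} (u : TangentSpace (𝓡 n) p) (i : Fin n) :
    component u i = (show EuclideanSpace ℝ (Fin n) from u) i := by
  have : IsManifold (𝓡 n) 1 M := IsManifold.of_le (n := ∞) (by norm_num)
  unfold component mvfderiv
  rw [mfderiv_extChartAt_self]
  rfl

theorem coordVector_self (p : M) (i : Fin n) :
    coordVector p (extChartAt (𝓡 n) p p) i =
      (EuclideanSpace.single i (1 : ℝ) : EuclideanSpace ℝ (Fin n)) := by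
  have : IsManifold (𝓡 n) 1 M := IsManifold.of_le (n := ∞) (by norm_num)
  have h := mfderivWithin_range_extChartAt_symm (I := 𝓡 n) (x := p)
  unfold coordVector
  rw [modelWithCornersSelf_coe, Set.range_id, mfderivWithin_univ] at h
  rw [h]
  rfl

theorem metricMatrix_self (g : Metric n M) (p : M) (i j : Fin n) :
    metricMatrix g p (extChartAt (𝓡 n) p p) i j =
      g.inner p (EuclideanSpace.single i (1 : ℝ) : EuclideanSpace ℝ (Fin n))
        (EuclideanSpace.single j (1 : ℝ) : EuclideanSpace ℝ (Fin n)) := by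
  -- The base point is recovered from its coordinates only up to a propositional equality on which
  -- the tangent space depends; a variable `q` makes substitution possible.
  have key : ∀ q : M, q = p → ∀ a b : EuclideanSpace ℝ (Fin n),
      g.inner q a b = g.inner p a b := by
    rintro q rfl a b
    rfl
  simp only [metricMatrix, Matrix.of_apply]
  rw [coordVector_self, coordVector_self]
  exact key _ (extChartAt_to_inv p) _ _

/-- The coordinate field is the derivative of the smooth inverse chart applied to a constant field.
-/
theorem contMDiffAt_coordVector (p : M) (i : Fin n) {y : EuclideanSpace ℝ (Fin n)}
    (hy : y ∈ (extChartAt (𝓡 n) p).target) :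
    ContMDiffAt (𝓡 n) ((𝓡 n).prod 𝓘(ℝ, EuclideanSpace ℝ (Fin n))) ∞
      (fun z => Bundle.TotalSpace.mk' (EuclideanSpace ℝ (Fin n))
        (E := fun x : M => TangentSpace (𝓡 n) x)
        ((extChartAt (𝓡 n) p).symm z) (coordVector p z i)) y := by
  have hsymm : ContMDiffAt (𝓡 n) (𝓡 n) ∞ (extChartAt (𝓡 n) p).symm y :=
    (contMDiffOn_extChartAt_symm p).contMDiffAt ((isOpen_extChartAt_target p).mem_nhds hy)
  have h1 := hsymm.mfderiv_const (m := ∞) (by norm_num)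
  have h2 : ContMDiffAt (𝓡 n) ((𝓡 n).prod 𝓘(ℝ, EuclideanSpace ℝ (Fin n))) ∞
      (fun z => Bundle.TotalSpace.mk' (EuclideanSpace ℝ (Fin n))
        (E := fun x : EuclideanSpace ℝ (Fin n) => TangentSpace (𝓡 n) x)
        z (EuclideanSpace.single i (1 : ℝ) : EuclideanSpace ℝ (Fin n))) y := by
    apply contMDiffAt_vectorSpace_iff_contDiffAt.2
    exact contDiffAt_const
  exact ContMDiffAt.clm_apply_of_inCoordinates (b₁ := id) h1 h2 hsymm

theorem contDiffAt_metricMatrix (g : Metric n M) (p : M) (i j : Fin n)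
    {y : EuclideanSpace ℝ (Fin n)} (hy : y ∈ (extChartAt (𝓡 n) p).target) :
    ContDiffAt ℝ ∞ (fun z => metricMatrix g p z i j) y := by
  have hsymm : ContMDiffAt (𝓡 n) (𝓡 n) ∞ (extChartAt (𝓡 n) p).symm y :=
    (contMDiffOn_extChartAt_symm p).contMDiffAt ((isOpen_extChartAt_target p).mem_nhds hy)
  have h0 := (g.contMDiff ((extChartAt (𝓡 n) p).symm y)).comp y hsymm
  have h := ContMDiffAt.clm_bundle_apply₂ (F₃ := ℝ) (E₃ := fun _ : M => ℝ) h0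
    (contMDiffAt_coordVector p i hy) (contMDiffAt_coordVector p j hy)
  rw [Bundle.contMDiffAt_totalSpace] at h
  exact h.2.contDiffAt

theorem metricMatrix_symm (g : Metric n M) (p : M) (y : EuclideanSpace ℝ (Fin n)) (i j : Fin n) :
    metricMatrix g p y i j = metricMatrix g p y j i :=
  g.symm _ _ _

theorem inner_eq_sum_component (g : Metric n M) (p : M) (u v : TangentSpace (𝓡 n) p) :
    g.inner p u v = ∑ i, ∑ j, component u i * component v j *
      metricMatrix g p (extChartAt (𝓡 n) p p) i j := by
  have hexp : ∀ w : EuclideanSpace ℝ (Fin n), w = ∑ i, w i • EuclideanSpace.single i (1 : ℝ) := by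
    intro w
    ext j
    simp [Finset.sum_apply, Pi.single_apply]
  have key : ∀ (B : EuclideanSpace ℝ (Fin n) →L[ℝ] EuclideanSpace ℝ (Fin n) →L[ℝ] ℝ)
      (u v : EuclideanSpace ℝ (Fin n)), B u v =
        ∑ i, ∑ j, u i * v j * B (EuclideanSpace.single i 1) (EuclideanSpace.single j 1) := by
    intro B u v
    conv_lhs => rw [hexp u, hexp v]
    simp only [map_sum, map_smul, sum_apply, smul_apply,
      smul_eq_mul, Finset.mul_sum]
    rw [Finset.sum_comm]
    refine Finset.sum_congr rfl fun i _ => Finset.sum_congr rfl fun j _ => by ring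
  simp only [metricMatrix_self, component_eq]
  exact key (g.inner p) u v

theorem metricMatrix_posDef (g : Metric n M) (p : M) :
    (metricMatrix g p (extChartAt (𝓡 n) p p)).PosDef := by
  refine Matrix.PosDef.of_dotProduct_mulVec_pos ?_ ?_
  · ext i j
    simp [metricMatrix_symm g p _ i j]
  · intro x hx
    obtain ⟨u, hu⟩ : ∃ u : TangentSpace (𝓡 n) p, ∀ i, component u i = x i :=
      ⟨(WithLp.toLp 2 x : EuclideanSpace ℝ (Fin n)), fun i => component_eq _ i⟩
    have hu0 : u ≠ 0 := by
      rintro rfl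
      exact hx (funext fun i => (hu i).symm.trans (component_eq _ i))
    have h := g.pos p u hu0
    rw [inner_eq_sum_component] at h
    refine h.trans_eq ?_
    simp only [hu, dotProduct, Matrix.mulVec, Finset.mul_sum]
    refine Finset.sum_congr rfl fun i _ => Finset.sum_congr rfl fun j _ => ?_
    simp only [star_trivial]
    ring

end Chart
end RiemannianCurvature

/-! ### Calculus of partial derivatives. -/

namespace RiemannianCurvature
section PartialDeriv
open Filter Topology
variable {n : ℕ}

theorem partialDeriv_congr {i : Fin n} {f h : EuclideanSpace ℝ (Fin n) → ℝ}
    {y : EuclideanSpace ℝ (Fin n)} (hfh : f =ᶠ[𝓝 y] h) :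
    partialDeriv i f y = partialDeriv i h y := by
  unfold partialDeriv
  rw [hfh.fderiv_eq]

theorem partialDeriv_add {i : Fin n} {f h : EuclideanSpace ℝ (Fin n) → ℝ}
    {y : EuclideanSpace ℝ (Fin n)} (hf : DifferentiableAt ℝ f y) (hh : DifferentiableAt ℝ h y) :
    partialDeriv i (fun z => f z + h z) y = partialDeriv i f y + partialDeriv i h y := by
  unfold partialDeriv
  rw [fderiv_fun_add hf hh]
  rfl

theorem partialDeriv_sum_mul {ι : Type*} (s : Finset ι) {i : Fin n}
    {f h : ι → EuclideanSpace ℝ (Fin n) → ℝ} {y : EuclideanSpace ℝ (Fin n)}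
    (hf : ∀ a, DifferentiableAt ℝ (f a) y) (hh : ∀ a, DifferentiableAt ℝ (h a) y) :
    partialDeriv i (fun z => ∑ a ∈ s, f a z * h a z) y =
      ∑ a ∈ s, (partialDeriv i (f a) y * h a y + f a y * partialDeriv i (h a) y) := by
  unfold partialDeriv
  rw [fderiv_fun_sum (A := fun a z => f a z * h a z) fun a _ => (hf a).mul (hh a)]
  rw [sum_apply]
  refine Finset.sum_congr rfl fun a _ => ?_
  rw [fderiv_fun_mul (hf a) (hh a)]
  simp
  ring

theorem contDiffAt_partialDeriv {i : Fin n} {f : EuclideanSpace ℝ (Fin n) → ℝ}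
    {y : EuclideanSpace ℝ (Fin n)} (hf : ContDiffAt ℝ ∞ f y) :
    ContDiffAt ℝ ∞ (partialDeriv i f) y :=
  (hf.fderiv_right (m := ∞) (by norm_num)).clm_apply contDiffAt_const

theorem partialDeriv_comm {i j : Fin n} {f : EuclideanSpace ℝ (Fin n) → ℝ}
    {y : EuclideanSpace ℝ (Fin n)} (hf : ContDiffAt ℝ ∞ f y) :
    partialDeriv i (partialDeriv j f) y = partialDeriv j (partialDeriv i f) y := by
  have hd : DifferentiableAt ℝ (fderiv ℝ f) y :=
    (hf.fderiv_right (m := 1) (by norm_cast)).differentiableAt one_ne_zero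
  have key : ∀ a b : Fin n, partialDeriv a (partialDeriv b f) y =
      fderiv ℝ (fderiv ℝ f) y (EuclideanSpace.single a 1) (EuclideanSpace.single b 1) := by
    intro a b
    unfold partialDeriv
    rw [fderiv_clm_apply hd (differentiableAt_const _)]
    simp
  rw [key, key]
  exact (hf.isSymmSndFDerivAt (by
    rw [minSmoothness_of_isRCLikeNormedField]
    exact WithTop.coe_le_coe.2 (le_top : (2 : ℕ∞) ≤ ⊤))) _ _

end PartialDeriv

/-! ### Symmetries of the curvature tensor from the Christoffel symbols. -/

section Symmetries
open Filter Topology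
variable {n : ℕ} {M : Type*} [TopologicalSpace M] [ChartedSpace (EuclideanSpace ℝ (Fin n)) M]
  [IsManifold (𝓡 n) ∞ M]

/-- The Christoffel symbol of the first kind `Γₗᵢⱼ = ∑ₖ gₗₖ Γᵏᵢⱼ` in the chart at `p`. -/
def christoffelFirst (g : Metric n M) (p : M) (l i j : Fin n) (y : EuclideanSpace ℝ (Fin n)) : ℝ :=
  (1 / 2) * (partialDeriv i (fun z => metricMatrix g p z j l) y
      + partialDeriv j (fun z => metricMatrix g p z i l) y
      - partialDeriv l (fun z => metricMatrix g p z i j) y)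

theorem christoffel_eq_sum (g : Metric n M) (p : M) (k i j : Fin n)
    (y : EuclideanSpace ℝ (Fin n)) :
    christoffel g p k i j y = ∑ l, (metricMatrix g p y)⁻¹ k l * christoffelFirst g p l i j y := by
  simp only [christoffel, christoffelFirst, Finset.mul_sum]
  exact Finset.sum_congr rfl fun l _ => by ring

theorem christoffelFirst_symm (g : Metric n M) (p : M) (l i j : Fin n)
    (y : EuclideanSpace ℝ (Fin n)) :
    christoffelFirst g p l i j y = christoffelFirst g p l j i y := by
  have : (fun z => metricMatrix g p z i j) = fun z => metricMatrix g p z j i :=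
    funext fun z => metricMatrix_symm g p z i j
  simp only [christoffelFirst, this]
  ring

theorem christoffel_symm (g : Metric n M) (p : M) (k i j : Fin n)
    (y : EuclideanSpace ℝ (Fin n)) :
    christoffel g p k i j y = christoffel g p k j i y := by
  simp only [christoffel_eq_sum, christoffelFirst_symm g p _ i j]

/-- Metric compatibility of the Levi-Civita connection. -/
theorem partialDeriv_metricMatrix (g : Metric n M) (p : M) (i l m : Fin n)
    (y : EuclideanSpace ℝ (Fin n)) :
    partialDeriv i (fun z => metricMatrix g p z l m) y =
      christoffelFirst g p l i m y + christoffelFirst g p m i l y := by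
  have h : ∀ a b, (fun z => metricMatrix g p z a b) = fun z => metricMatrix g p z b a :=
    fun a b => funext fun z => metricMatrix_symm g p z a b
  simp only [christoffelFirst]
  rw [h m l, h i m, h i l]
  ring

variable (g : Metric n M) (p : M)

theorem contDiffAt_metricMatrix_self (i j : Fin n) :
    ContDiffAt ℝ ∞ (fun z => metricMatrix g p z i j) (extChartAt (𝓡 n) p p) :=
  contDiffAt_metricMatrix g p i j (mem_extChartAt_target p)

theorem contDiffAt_christoffelFirst (l i j : Fin n) :
    ContDiffAt ℝ ∞ (christoffelFirst g p l i j) (extChartAt (𝓡 n) p p) :=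
  contDiffAt_const.mul
    (((contDiffAt_partialDeriv (contDiffAt_metricMatrix_self g p j l)).add
      (contDiffAt_partialDeriv (contDiffAt_metricMatrix_self g p i l))).sub
      (contDiffAt_partialDeriv (contDiffAt_metricMatrix_self g p i j)))

theorem contDiffAt_det {A : EuclideanSpace ℝ (Fin n) → Matrix (Fin n) (Fin n) ℝ}
    {y : EuclideanSpace ℝ (Fin n)} (hA : ∀ i j, ContDiffAt ℝ ∞ (fun z => A z i j) y) :
    ContDiffAt ℝ ∞ (fun z => (A z).det) y := by
  simp only [Matrix.det_apply]
  exact ContDiffAt.sum fun σ _ => (contDiffAt_prod fun i _ => hA _ _).const_smul _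

theorem det_metricMatrix_self_ne_zero : (metricMatrix g p (extChartAt (𝓡 n) p p)).det ≠ 0 :=
  (metricMatrix_posDef g p).det_pos.ne'

theorem contDiffAt_inv_metricMatrix (i j : Fin n) :
    ContDiffAt ℝ ∞ (fun z => (metricMatrix g p z)⁻¹ i j) (extChartAt (𝓡 n) p p) := by
  simp only [Matrix.inv_def, Matrix.smul_apply, Ring.inverse_eq_inv', smul_eq_mul,
    Matrix.adjugate_apply]
  refine ((contDiffAt_det fun a b => contDiffAt_metricMatrix_self g p a b).inv
    (det_metricMatrix_self_ne_zero g p)).mul (contDiffAt_det fun a b => ?_)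
  simp only [Matrix.updateRow_apply]
  split_ifs
  · exact contDiffAt_const
  · exact contDiffAt_metricMatrix_self g p a b

theorem contDiffAt_christoffel (k i j : Fin n) :
    ContDiffAt ℝ ∞ (christoffel g p k i j) (extChartAt (𝓡 n) p p) := by
  rw [funext (christoffel_eq_sum g p k i j)]
  exact ContDiffAt.sum fun l _ =>
    (contDiffAt_inv_metricMatrix g p k l).mul (contDiffAt_christoffelFirst g p l i j)

theorem sum_metricMatrix_mul_christoffel {y : EuclideanSpace ℝ (Fin n)}
    (hy : (metricMatrix g p y).det ≠ 0) (l i j : Fin n) :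
    ∑ k, metricMatrix g p y l k * christoffel g p k i j y = christoffelFirst g p l i j y := by
  have h : ((metricMatrix g p y).mulVec ((metricMatrix g p y)⁻¹.mulVec
      fun a => christoffelFirst g p a i j y)) l = christoffelFirst g p l i j y := by
    rw [Matrix.mulVec_mulVec, Matrix.mul_nonsing_inv _ (isUnit_iff_ne_zero.2 hy),
      Matrix.one_mulVec]
  rw [← h]
  simp only [christoffel_eq_sum, Matrix.mulVec, dotProduct]

theorem partialDeriv_christoffelFirst (a l i j : Fin n) :
    partialDeriv a (christoffelFirst g p l i j) (extChartAt (𝓡 n) p p) =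
      ∑ k, (partialDeriv a (fun z => metricMatrix g p z l k) (extChartAt (𝓡 n) p p) *
          christoffel g p k i j (extChartAt (𝓡 n) p p) +
        metricMatrix g p (extChartAt (𝓡 n) p p) l k *
          partialDeriv a (christoffel g p k i j) (extChartAt (𝓡 n) p p)) := by
  rw [← partialDeriv_sum_mul (f := fun k z => metricMatrix g p z l k)
    (h := fun k => christoffel g p k i j) Finset.univ
    (fun k => (contDiffAt_metricMatrix_self g p l k).differentiableAt (by simp))
    (fun k => (contDiffAt_christoffel g p k i j).differentiableAt (by simp))]
  refine partialDeriv_congr ?_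
  -- Lowering an index inverts the matrix only where it is nonsingular, so the identity to be
  -- differentiated is known near the base point, by continuity of the determinant.
  have hdet : ContinuousAt (fun z => (metricMatrix g p z).det) (extChartAt (𝓡 n) p p) :=
    (contDiffAt_det fun a b => contDiffAt_metricMatrix_self g p a b).continuousAt
  filter_upwards [hdet.eventually_ne (det_metricMatrix_self_ne_zero g p)] with z hz
  exact (sum_metricMatrix_mul_christoffel g p hz l i j).symm

/-- Moving the metric inside the derivative costs `∂ᵢ gₗₘ = Γₗᵢₘ + Γₘᵢₗ`. The first term cancels the
quadratic part of `curvatureUp`; the second survives with the opposite sign. -/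
theorem curvatureCoord_eq (i j k l : Fin n) :
    curvatureCoord g p i j k l =
      partialDeriv i (christoffelFirst g p l j k) (extChartAt (𝓡 n) p p)
        - partialDeriv j (christoffelFirst g p l i k) (extChartAt (𝓡 n) p p)
        - ∑ m, christoffelFirst g p m i l (extChartAt (𝓡 n) p p)
            * christoffel g p m j k (extChartAt (𝓡 n) p p)
        + ∑ m, christoffelFirst g p m j l (extChartAt (𝓡 n) p p)
            * christoffel g p m i k (extChartAt (𝓡 n) p p) := by
  simp only [partialDeriv_christoffelFirst, partialDeriv_metricMatrix, curvatureCoord, curvatureUp]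
  set y := extChartAt (𝓡 n) p p with hy
  have hG : ∀ a i j, christoffelFirst g p a i j y =
      ∑ k, metricMatrix g p y a k * christoffel g p k i j y := fun a i j =>
    (sum_metricMatrix_mul_christoffel g p (det_metricMatrix_self_ne_zero g p) a i j).symm
  have hA : ∀ i j k : Fin n, ∑ m, (∑ q, christoffel g p q j k y * christoffel g p m i q y)
      * metricMatrix g p y m l = ∑ q, christoffelFirst g p l i q y * christoffel g p q j k y := by
    intro i j k
    simp only [hG, Finset.sum_mul]
    rw [Finset.sum_comm]
    refine Finset.sum_congr rfl fun q _ => Finset.sum_congr rfl fun m _ => ?_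
    rw [metricMatrix_symm g p y m l]
    ring
  simp only [add_mul, sub_mul, Finset.sum_add_distrib, Finset.sum_sub_distrib, hA,
    metricMatrix_symm g p y l]
  simp only [mul_comm (partialDeriv _ _ _)]
  ring

theorem christoffelFirst_mul_christoffel_symm (y : EuclideanSpace ℝ (Fin n))
    (hy : (metricMatrix g p y).det ≠ 0) (a b c d : Fin n) :
    ∑ m, christoffelFirst g p m a b y * christoffel g p m c d y =
      ∑ m, christoffelFirst g p m c d y * christoffel g p m a b y := by
  simp only [← sum_metricMatrix_mul_christoffel g p hy, Finset.sum_mul]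
  rw [Finset.sum_comm]
  refine Finset.sum_congr rfl fun q _ => Finset.sum_congr rfl fun m _ => ?_
  rw [metricMatrix_symm g p y m q]
  ring

theorem curvatureCoord_antisymm_left (i j k l : Fin n) :
    curvatureCoord g p i j k l = -curvatureCoord g p j i k l := by
  simp only [curvatureCoord_eq]
  ring

/-- Symmetrizing the derivative terms in `k, l` gives mixed second derivatives of `gₗₖ`, which
commute; the quadratic terms cancel by symmetry of the metric pairing. -/
theorem curvatureCoord_antisymm_right (i j k l : Fin n) :
    curvatureCoord g p i j k l = -curvatureCoord g p i j l k := by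
  have hdet := det_metricMatrix_self_ne_zero g p
  have hd : ∀ a b c, DifferentiableAt ℝ (christoffelFirst g p a b c) (extChartAt (𝓡 n) p p) :=
    fun a b c => (contDiffAt_christoffelFirst g p a b c).differentiableAt (by simp)
  have key : ∀ a b, partialDeriv a (christoffelFirst g p l b k) (extChartAt (𝓡 n) p p) +
      partialDeriv a (christoffelFirst g p k b l) (extChartAt (𝓡 n) p p) =
      partialDeriv a (partialDeriv b fun z => metricMatrix g p z l k) (extChartAt (𝓡 n) p p) := by
    intro a b
    rw [← partialDeriv_add (hd _ _ _) (hd _ _ _)]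
    exact congrArg (fun f => partialDeriv a f _)
      (funext fun y => (partialDeriv_metricMatrix g p b l k y).symm)
  have hc := partialDeriv_comm (i := i) (j := j) (contDiffAt_metricMatrix_self g p l k)
  rw [← key, ← key] at hc
  simp only [curvatureCoord_eq]
  rw [christoffelFirst_mul_christoffel_symm g p _ hdet i l j k,
    christoffelFirst_mul_christoffel_symm g p _ hdet j l i k]
  linarith

/-- Torsion-freeness: the Christoffel symbols are symmetric in their lower indices, so the cyclic
sum cancels term by term. -/
theorem curvatureCoord_bianchi (i j k l : Fin n) :
    curvatureCoord g p i j k l + curvatureCoord g p j k i l + curvatureCoord g p k i j l = 0 := by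
  simp only [curvatureCoord_eq]
  rw [funext (christoffelFirst_symm g p l k j), funext (christoffelFirst_symm g p l i k),
    funext (christoffelFirst_symm g p l j i)]
  simp only [christoffel_symm g p _ k j, christoffel_symm g p _ i k, christoffel_symm g p _ j i]
  ring

end Symmetries
end RiemannianCurvature

/-! ### Simultaneous singular value decomposition of an intertwiner. -/

section SingularVectors
open scoped InnerProductSpace
open Module

theorem LinearMap.IsSymmetric.exists_unit_eigenvector {E : Type*} [NormedAddCommGroup E]
    [InnerProductSpace ℝ E] [FiniteDimensional ℝ E] [Nontrivial E] {A : E →ₗ[ℝ] E}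
    (hA : A.IsSymmetric) : ∃ (u : E) (a : ℝ), ‖u‖ = 1 ∧ A u = a • u := by
  have hpos : 0 < finrank ℝ E := finrank_pos
  refine ⟨hA.eigenvectorBasis rfl ⟨0, hpos⟩, hA.eigenvalues rfl ⟨0, hpos⟩,
    (hA.eigenvectorBasis rfl).orthonormal.1 _, ?_⟩
  simp

theorem LinearMap.IsSymmetric.exists_ne_zero_eigenvalue {E : Type*} [NormedAddCommGroup E]
    [InnerProductSpace ℝ E] [FiniteDimensional ℝ E] {P : E →ₗ[ℝ] E}
    (hP : P.IsSymmetric) (h0 : P ≠ 0) : ∃ (r : ℝ) (u : E), r ≠ 0 ∧ u ≠ 0 ∧ P u = r • u := by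
  by_contra! h
  refine h0 ((hP.eigenvectorBasis rfl).toBasis.ext fun i => ?_)
  have h1 := hP.apply_eigenvectorBasis rfl i
  by_cases hi : hP.eigenvalues rfl i = 0
  · simp [hi]
  · exact absurd h1
      (h _ _ hi (norm_ne_zero_iff.1 (by rw [(hP.eigenvectorBasis rfl).orthonormal.1 i]; simp)))

variable {E F : Type*} [NormedAddCommGroup E] [InnerProductSpace ℝ E] [FiniteDimensional ℝ E]
  [NormedAddCommGroup F] [InnerProductSpace ℝ F] [FiniteDimensional ℝ F]

/-- If symmetric operators `A`, `C` are intertwined by `Z`, then `Z` and its adjoint `W` have a pair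
of singular vectors which are eigenvectors of `A` and `C`. -/
theorem exists_unit_singular_pair [Nontrivial E] [Nontrivial F] {A : E →ₗ[ℝ] E} {C : F →ₗ[ℝ] F}
    {Z : F →ₗ[ℝ] E} {W : E →ₗ[ℝ] F} (hA : A.IsSymmetric) (hC : C.IsSymmetric)
    (hZW : ∀ y x, ⟪Z y, x⟫_ℝ = ⟪y, W x⟫_ℝ) (hAZ : ∀ y, A (Z y) = Z (C y)) :
    ∃ (u : E) (v : F) (a c z : ℝ), ‖u‖ = 1 ∧ ‖v‖ = 1 ∧ A u = a • u ∧ C v = c • v ∧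
      Z v = z • u ∧ W u = z • v := by
  have hWA : ∀ x, W (A x) = C (W x) := fun x => ext_inner_left ℝ fun y => by
    rw [← hZW, ← hA, hAZ, hZW, hC]
  by_cases hW : W = 0
  · have hZ : ∀ y, Z y = 0 := fun y => ext_inner_right ℝ fun x => by simp [hZW, hW]
    obtain ⟨u, a, hu, hua⟩ := hA.exists_unit_eigenvector
    obtain ⟨v, c, hv, hvc⟩ := hC.exists_unit_eigenvector
    exact ⟨u, v, a, c, 0, hu, hv, hua, hvc, by simp [hZ], by simp [hW]⟩
  · have hP : (Z ∘ₗ W).IsSymmetric := fun x y => by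
      simp only [LinearMap.comp_apply]
      rw [hZW, real_inner_comm, ← hZW, real_inner_comm]
    have hP0 : Z ∘ₗ W ≠ 0 := by
      intro h
      refine hW (LinearMap.ext fun x => inner_self_eq_zero (𝕜 := ℝ).1 ?_)
      have := congrArg (fun f : E →ₗ[ℝ] E => ⟪f x, x⟫_ℝ) h
      simpa [hZW] using this
    obtain ⟨r, w, hr, hw, hrw⟩ := hP.exists_ne_zero_eigenvalue hP0
    -- `A` commutes with `Z W`, because `A Z W = Z C W = Z W A`. Hence `A` preserves this eigenspace
    -- and has an eigenvector `u` in it.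
    let K := Module.End.eigenspace (Z ∘ₗ W) r
    have hK : ∀ x, x ∈ K ↔ Z (W x) = r • x := fun x => Module.End.mem_eigenspace_iff
    have hAK : ∀ x ∈ K, A x ∈ K := by
      intro x hx
      rw [hK] at hx ⊢
      rw [hWA, ← hAZ, hx, map_smul]
    have : Nontrivial K := ⟨⟨⟨w, (hK w).2 hrw⟩, 0, fun h => hw (congrArg Subtype.val h)⟩⟩
    obtain ⟨⟨u, huK⟩, a, hu, hua⟩ := (hA.restrict_invariant hAK).exists_unit_eigenvector
    replace hua : A u = a • u := congrArg Subtype.val hua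
    replace hu : ‖u‖ = 1 := hu
    rw [hK] at huK
    have hnorm : ‖W u‖ ^ 2 = r := by
      rw [← real_inner_self_eq_norm_sq, ← hZW, huK, real_inner_smul_left,
        real_inner_self_eq_norm_sq, hu]
      simp
    have hne : ‖W u‖ ≠ 0 := fun h => hr (by rw [← hnorm, h]; simp)
    -- Here `r = ‖W u‖²` is nonzero, so `W u` can be normalized; `C W u = W A u` gives it the same
    -- eigenvalue as `u`.
    refine ⟨u, ‖W u‖⁻¹ • W u, a, a, ‖W u‖, hu, ?_, hua, ?_, ?_, ?_⟩
    · rw [norm_smul, norm_inv, norm_norm, inv_mul_cancel₀ hne]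
    · rw [map_smul, ← hWA, hua, map_smul, smul_comm]
    · rw [map_smul, huK, ← hnorm, smul_smul]
      congr 1
      field_simp
    · rw [smul_smul, mul_inv_cancel₀ hne, one_smul]

theorem orthonormal_finCons {E : Type*} [NormedAddCommGroup E] [InnerProductSpace ℝ E] {n : ℕ}
    {u : E} (hu : ‖u‖ = 1) {w : Fin n → (ℝ ∙ u)ᗮ} (hw : Orthonormal ℝ w) :
    Orthonormal ℝ (Fin.cons u fun i => (w i : E) : Fin (n + 1) → E) := by
  have h0 : ∀ i, ⟪u, (w i : E)⟫_ℝ = 0 := fun i =>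
    Submodule.mem_orthogonal_singleton_iff_inner_right.1 (w i).2
  rw [orthonormal_iff_ite] at hw ⊢
  intro i j
  refine Fin.cases ?_ (fun i => ?_) i <;> refine Fin.cases ?_ (fun j => ?_) j
  · simp [hu]
  · simpa [(Fin.succ_ne_zero j).symm] using h0 j
  · simpa [real_inner_comm u] using h0 i
  · simpa using hw i j

/-- Simultaneous singular value decomposition: if `A`, `C` are symmetric and `A Z = Z C`, there are
orthonormal bases in which `A`, `C` and `Z` are diagonal. -/
theorem exists_orthonormal_singular_bases {n : ℕ} {E F : Type*} [NormedAddCommGroup E]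
    [InnerProductSpace ℝ E] [FiniteDimensional ℝ E] [NormedAddCommGroup F]
    [InnerProductSpace ℝ F] [FiniteDimensional ℝ F] (hE : finrank ℝ E = n) (hF : finrank ℝ F = n)
    {A : E →ₗ[ℝ] E} {C : F →ₗ[ℝ] F} {Z : F →ₗ[ℝ] E} {W : E →ₗ[ℝ] F} (hA : A.IsSymmetric)
    (hC : C.IsSymmetric) (hZW : ∀ y x, ⟪Z y, x⟫_ℝ = ⟪y, W x⟫_ℝ) (hAZ : ∀ y, A (Z y) = Z (C y)) :
    ∃ (u : Fin n → E) (v : Fin n → F) (a c z : Fin n → ℝ), Orthonormal ℝ u ∧ Orthonormal ℝ v ∧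
      ∀ i, A (u i) = a i • u i ∧ C (v i) = c i • v i ∧ Z (v i) = z i • u i := by
  induction n generalizing E F with
  | zero =>
    exact ⟨Fin.elim0, Fin.elim0, Fin.elim0, Fin.elim0, Fin.elim0, ⟨fun i => i.elim0,
      fun i => i.elim0⟩, ⟨fun i => i.elim0, fun i => i.elim0⟩, fun i => i.elim0⟩
  | succ n ih =>
    have : Nontrivial E := nontrivial_of_finrank_pos (R := ℝ) (by omega)
    have : Nontrivial F := nontrivial_of_finrank_pos (R := ℝ) (by omega)
    obtain ⟨u, v, a, c, z, hu, hv, hAu, hCv, hZv, hWu⟩ := exists_unit_singular_pair hA hC hZW hAZ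
    have hu0 : u ≠ 0 := norm_ne_zero_iff.1 (by rw [hu]; simp)
    have hv0 : v ≠ 0 := norm_ne_zero_iff.1 (by rw [hv]; simp)
    have : Fact (finrank ℝ E = n + 1) := ⟨hE⟩
    have : Fact (finrank ℝ F = n + 1) := ⟨hF⟩
    -- Since `u`, `v` are eigenvectors and singular vectors for both `Z` and its adjoint, all four
    -- maps restrict to the orthogonal complements, where induction applies.
    have mA : ∀ x ∈ (ℝ ∙ u)ᗮ, A x ∈ (ℝ ∙ u)ᗮ := by
      intro x hx
      rw [Submodule.mem_orthogonal_singleton_iff_inner_right] at hx ⊢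
      rw [← hA, hAu, real_inner_smul_left, hx, mul_zero]
    have mC : ∀ x ∈ (ℝ ∙ v)ᗮ, C x ∈ (ℝ ∙ v)ᗮ := by
      intro x hx
      rw [Submodule.mem_orthogonal_singleton_iff_inner_right] at hx ⊢
      rw [← hC, hCv, real_inner_smul_left, hx, mul_zero]
    have mZ : ∀ x ∈ (ℝ ∙ v)ᗮ, Z x ∈ (ℝ ∙ u)ᗮ := by
      intro x hx
      rw [Submodule.mem_orthogonal_singleton_iff_inner_right] at hx
      rw [Submodule.mem_orthogonal_singleton_iff_inner_left]
      rw [hZW, hWu, real_inner_smul_right, real_inner_comm, hx, mul_zero]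
    have mW : ∀ x ∈ (ℝ ∙ u)ᗮ, W x ∈ (ℝ ∙ v)ᗮ := by
      intro x hx
      rw [Submodule.mem_orthogonal_singleton_iff_inner_right] at hx ⊢
      rw [← hZW, hZv, real_inner_smul_left, hx, mul_zero]
    obtain ⟨u', v', a', c', z', hu', hv', h'⟩ := ih
      (Submodule.finrank_orthogonal_span_singleton hu0)
      (Submodule.finrank_orthogonal_span_singleton hv0)
      (A := A.restrict mA) (C := C.restrict mC) (Z := Z.restrict mZ) (W := W.restrict mW)
      (hA.restrict_invariant mA) (hC.restrict_invariant mC)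
      (fun y x => hZW y x) (fun y => Subtype.ext (hAZ y))
    refine ⟨Fin.cons u fun i => (u' i : E), Fin.cons v fun i => (v' i : F), Fin.cons a a',
      Fin.cons c c', Fin.cons z z', orthonormal_finCons hu hu', orthonormal_finCons hv hv',
      fun i => ?_⟩
    refine Fin.cases ?_ (fun i => ?_) i
    · simpa using ⟨hAu, hCv, hZv⟩
    · obtain ⟨h1, h2, h3⟩ := h' i
      simpa using ⟨congrArg Subtype.val h1, congrArg Subtype.val h2, congrArg Subtype.val h3⟩

end SingularVectors

/-! ### Algebraic curvature tensors in dimension four and their bivector blocks. -/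

section AlgebraicCurvature

/-- The symmetries of an algebraic curvature tensor, in components. -/
structure IsAlgebraicCurvature {n : ℕ} (T : Fin n → Fin n → Fin n → Fin n → ℝ) : Prop where
  antisymm_left : ∀ a b c d, T a b c d = -T b a c d
  antisymm_right : ∀ a b c d, T a b c d = -T a b d c
  bianchi : ∀ a b c d, T a b c d + T b c a d + T c a b d = 0

/-- The octahedron argument: a linear combination of four Bianchi identities, with terms matched by
antisymmetry. -/
theorem IsAlgebraicCurvature.pair_symm {n : ℕ} {T : Fin n → Fin n → Fin n → Fin n → ℝ}
    (hT : IsAlgebraicCurvature T) (a b c d : Fin n) : T a b c d = T c d a b := by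
  have h1 := hT.bianchi a b c d
  have h2 := hT.bianchi b c d a
  have h3 := hT.bianchi c d a b
  have h4 := hT.bianchi d a b c
  have e1 := hT.antisymm_right b c a d
  have e2 := hT.antisymm_right c a b d
  have e3 := hT.antisymm_left c a d b
  have e4 := hT.antisymm_right c d b a
  have e5 := hT.antisymm_left d b c a
  have e6 := hT.antisymm_right b d c a
  have e7 := hT.antisymm_right d a c b
  have e8 := hT.antisymm_right a b d c
  have e9 := hT.antisymm_right a c d b
  have e10 := hT.antisymm_left a c b d
  linarith

/-- `Řᵢⱼ = ∑ R_{abci} R_{abcj}` for the components of a tensor in an orthonormal basis. -/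
def tensorSquare {n : ℕ} (T : Fin n → Fin n → Fin n → Fin n → ℝ) (i j : Fin n) : ℝ :=
  ∑ a, ∑ b, ∑ c, T a b c i * T a b c j

/-- The weakly Einstein condition for the components of a curvature tensor in an orthonormal
basis. -/
def IsWeaklyEinsteinTensor {n : ℕ} (T : Fin n → Fin n → Fin n → Fin n → ℝ) : Prop :=
  ∀ i j, tensorSquare T i j = if i = j then (1 / n) * ∑ k, tensorSquare T k k else 0

variable {T : Fin 4 → Fin 4 → Fin 4 → Fin 4 → ℝ}

theorem IsAlgebraicCurvature.apply_self_left (hT : IsAlgebraicCurvature T) (a c d : Fin 4) :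
    T a a c d = 0 := by
  linarith [hT.antisymm_left a a c d]

theorem IsAlgebraicCurvature.apply_self_right (hT : IsAlgebraicCurvature T) (a b c : Fin 4) :
    T a b c c = 0 := by
  linarith [hT.antisymm_right a b c c]

/-- Blocks of the curvature operator with respect to the splitting of bivectors in dimension 4 into
self-dual and anti-self-dual ones, selected by the signs `s` and `t`. -/
def curvatureBlock (T : Fin 4 → Fin 4 → Fin 4 → Fin 4 → ℝ) (s t : ℝ) : Matrix (Fin 3) (Fin 3) ℝ :=
  Matrix.of fun i j =>
    T 0 (![1, 2, 3] i) 0 (![1, 2, 3] j)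
      + t * T 0 (![1, 2, 3] i) (![2, 3, 1] j) (![3, 1, 2] j)
      + s * T (![2, 3, 1] i) (![3, 1, 2] i) 0 (![1, 2, 3] j)
      + s * t * T (![2, 3, 1] i) (![3, 1, 2] i) (![2, 3, 1] j) (![3, 1, 2] j)

/-- Matrix of the left multiplication by an imaginary quaternion. -/
def quaternionLeft (p : Fin 3 → ℝ) : Matrix (Fin 4) (Fin 4) ℝ :=
  !![0, -p 0, -p 1, -p 2; p 0, 0, -p 2, p 1; p 1, p 2, 0, -p 0; p 2, -p 1, p 0, 0]

/-- Matrix of the right multiplication by an imaginary quaternion. -/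
def quaternionRight (q : Fin 3 → ℝ) : Matrix (Fin 4) (Fin 4) ℝ :=
  !![0, -q 0, -q 1, -q 2; q 0, 0, q 2, -q 1; q 1, -q 2, 0, q 0; q 2, q 1, -q 0, 0]

/-- The curvature operator as a bilinear form on bivectors. -/
def bivectorForm (T : Fin 4 → Fin 4 → Fin 4 → Fin 4 → ℝ) (X Y : Matrix (Fin 4) (Fin 4) ℝ) : ℝ :=
  ∑ i, ∑ j, ∑ k, ∑ l, T i j k l * X i j * Y k l

/-- Rewrite rules expressing every component through those `T a b c d` with `a < b` and `c < d`. -/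
theorem IsAlgebraicCurvature.sort_indices (hT : IsAlgebraicCurvature T) :
    (∀ a c d, T a a c d = 0) ∧ (∀ a b c, T a b c c = 0) ∧
    (∀ c d, T 1 0 c d = -T 0 1 c d) ∧ (∀ c d, T 2 0 c d = -T 0 2 c d) ∧
    (∀ c d, T 3 0 c d = -T 0 3 c d) ∧ (∀ c d, T 2 1 c d = -T 1 2 c d) ∧
    (∀ c d, T 3 1 c d = -T 1 3 c d) ∧ (∀ c d, T 3 2 c d = -T 2 3 c d) ∧
    (∀ a b, T a b 1 0 = -T a b 0 1) ∧ (∀ a b, T a b 2 0 = -T a b 0 2) ∧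
    (∀ a b, T a b 3 0 = -T a b 0 3) ∧ (∀ a b, T a b 2 1 = -T a b 1 2) ∧
    (∀ a b, T a b 3 1 = -T a b 1 3) ∧ (∀ a b, T a b 3 2 = -T a b 2 3) :=
  ⟨hT.apply_self_left, hT.apply_self_right, hT.antisymm_left 1 0, hT.antisymm_left 2 0,
    hT.antisymm_left 3 0, hT.antisymm_left 2 1, hT.antisymm_left 3 1, hT.antisymm_left 3 2,
    fun a b => hT.antisymm_right a b 1 0, fun a b => hT.antisymm_right a b 2 0,
    fun a b => hT.antisymm_right a b 3 0, fun a b => hT.antisymm_right a b 2 1,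
    fun a b => hT.antisymm_right a b 3 1, fun a b => hT.antisymm_right a b 3 2⟩

/-- Rewrite rules exchanging the two pairs of indices into lexicographic order. -/
theorem IsAlgebraicCurvature.sort_pairs (hT : IsAlgebraicCurvature T) :
    (∀ d, T 2 3 0 d = T 0 d 2 3) ∧ (∀ d, T 1 3 0 d = T 0 d 1 3) ∧ (∀ d, T 1 2 0 d = T 0 d 1 2) ∧
    T 0 3 0 1 = T 0 1 0 3 ∧ T 0 3 0 2 = T 0 2 0 3 ∧ T 0 2 0 1 = T 0 1 0 2 ∧
    (∀ d, T 2 3 1 d = T 1 d 2 3) ∧ T 1 3 1 2 = T 1 2 1 3 :=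
  ⟨hT.pair_symm 2 3 0, hT.pair_symm 1 3 0, hT.pair_symm 1 2 0, hT.pair_symm 0 3 0 1,
    hT.pair_symm 0 3 0 2, hT.pair_symm 0 2 0 1, hT.pair_symm 2 3 1, hT.pair_symm 1 3 1 2⟩

/-- Left multiplications are the self-dual bivectors and right multiplications the anti-self-dual
ones, so the blocks are values of a form that transforms well under a change of frame. The factor 4
arises because the full sum visits each unordered index pair twice in either argument. -/
theorem bivectorForm_left_left (hT : IsAlgebraicCurvature T) (p q : Fin 3 → ℝ) :
    bivectorForm T (quaternionLeft p) (quaternionLeft q) =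
      4 * (p ⬝ᵥ (curvatureBlock T 1 1).mulVec q) := by
  simp [bivectorForm, quaternionLeft, curvatureBlock, Fin.sum_univ_four, dotProduct,
    Matrix.mulVec, Fin.sum_univ_three, hT.sort_indices]
  ring

theorem bivectorForm_left_right (hT : IsAlgebraicCurvature T) (p q : Fin 3 → ℝ) :
    bivectorForm T (quaternionLeft p) (quaternionRight q) =
      4 * (p ⬝ᵥ (curvatureBlock T 1 (-1)).mulVec q) := by
  simp [bivectorForm, quaternionLeft, quaternionRight, curvatureBlock, Fin.sum_univ_four,
    dotProduct, Matrix.mulVec, Fin.sum_univ_three, hT.sort_indices]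
  ring

theorem bivectorForm_right_right (hT : IsAlgebraicCurvature T) (p q : Fin 3 → ℝ) :
    bivectorForm T (quaternionRight p) (quaternionRight q) =
      4 * (p ⬝ᵥ (curvatureBlock T (-1) (-1)).mulVec q) := by
  simp [bivectorForm, quaternionRight, curvatureBlock, Fin.sum_univ_four, dotProduct,
    Matrix.mulVec, Fin.sum_univ_three, hT.sort_indices]
  ring

theorem curvatureBlock_transpose (hT : IsAlgebraicCurvature T) (s : ℝ) :
    (curvatureBlock T s s).transpose = curvatureBlock T s s := by
  ext i j
  simp only [curvatureBlock, Matrix.transpose_apply, Matrix.of_apply]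
  rw [hT.pair_symm 0 (![1, 2, 3] j) 0, hT.pair_symm 0 (![1, 2, 3] j) (![2, 3, 1] i),
    hT.pair_symm (![2, 3, 1] j) _ 0, hT.pair_symm (![2, 3, 1] j) _ (![2, 3, 1] i)]
  ring

/-- The trace-free symmetric tensors correspond to 3×3 matrices pairing self-dual with
anti-self-dual bivectors. Diagonal entries come from signed sums of the `Řᵢᵢ`, off-diagonal ones
from sums and differences of two `Řᵢⱼ` with complementary index pairs. -/
theorem curvatureBlock_anticommute (hT : IsAlgebraicCurvature T) (hW : IsWeaklyEinsteinTensor T) :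
    curvatureBlock T 1 1 * curvatureBlock T 1 (-1) =
      -(curvatureBlock T 1 (-1) * curvatureBlock T (-1) (-1)) := by
  have h00 := hW 0 0
  have h01 := hW 0 1
  have h02 := hW 0 2
  have h03 := hW 0 3
  have h11 := hW 1 1
  have h12 := hW 1 2
  have h13 := hW 1 3
  have h22 := hW 2 2
  have h23 := hW 2 3
  have h33 := hW 3 3
  simp only [↓reduceIte, Fin.reduceEq, tensorSquare, Fin.sum_univ_four, hT.sort_indices,
    hT.sort_pairs] at h00 h01 h02 h03 h11 h12 h13 h22 h23 h33
  ext i j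
  fin_cases i <;> fin_cases j <;>
    simp [curvatureBlock, Matrix.mul_apply, Fin.sum_univ_three, hT.sort_indices, hT.sort_pairs]
  · linear_combination (1 / 2) * (h00 + h11 - h22 - h33)
  · linear_combination h12 - h03
  · linear_combination h13 + h02
  · linear_combination h12 + h03
  · linear_combination (1 / 2) * (h00 - h11 + h22 - h33)
  · linear_combination h23 - h01
  · linear_combination h13 - h02
  · linear_combination h23 + h01
  · linear_combination (1 / 2) * (h00 - h11 - h22 + h33)

/-- The conditions on the components of a curvature tensor in a generalized Singer-Thorpe basis. -/
structure IsGeneralizedSingerThorpeTensor (T : Fin 4 → Fin 4 → Fin 4 → Fin 4 → ℝ) : Prop where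
  offDiagonal : ∀ i j k, i ≠ k → T i j j k = 0
  sq_12_34 : T 0 1 0 1 ^ 2 = T 2 3 2 3 ^ 2
  sq_13_24 : T 0 2 0 2 ^ 2 = T 1 3 1 3 ^ 2
  sq_14_23 : T 0 3 0 3 ^ 2 = T 1 2 1 2 ^ 2

/-- Only components pairing a coordinate plane with itself or its complement survive. No product in
`Řᵢⱼ` with `i ≠ j` then has two nonzero factors. In `Řᵢᵢ` the complementary terms do not depend on
`i`, and the rest involves the squares for the three planes containing `i`, one from each
complementary pair. -/
theorem IsGeneralizedSingerThorpeTensor.isWeaklyEinsteinTensor (hT : IsAlgebraicCurvature T)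
    (h : IsGeneralizedSingerThorpeTensor T) : IsWeaklyEinsteinTensor T := by
  have z : ∀ i j k, i ≠ k → T i j j k = 0 := h.offDiagonal
  have h1 := z 0 1 2 (by decide)
  have h2 := z 0 1 3 (by decide)
  have h3 := z 2 1 3 (by decide)
  have h4 := z 0 2 1 (by decide)
  have h5 := z 0 2 3 (by decide)
  have h6 := z 1 2 3 (by decide)
  have h7 := z 0 3 1 (by decide)
  have h8 := z 0 3 2 (by decide)
  have h9 := z 1 3 2 (by decide)
  have h10 := z 1 0 2 (by decide)
  have h11 := z 1 0 3 (by decide)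
  have h12 := z 2 0 3 (by decide)
  simp only [hT.sort_indices, neg_eq_zero] at h1 h2 h3 h4 h5 h6 h7 h8 h9 h10 h11 h12
  have s1 := h.sq_12_34
  have s2 := h.sq_13_24
  have s3 := h.sq_14_23
  intro i j
  fin_cases i <;> fin_cases j <;>
    simp [tensorSquare, Fin.sum_univ_four, hT.sort_indices, hT.sort_pairs, h1, h2, h3, h4, h5, h6,
      h7, h8, h9, h10, h11, h12]
  all_goals linarith
end AlgebraicCurvature

/-! ### Quaternion multiplications and rotations of four-space. -/

section Quaternion
open Matrix

theorem quaternionLeft_mul (p q : Fin 3 → ℝ) :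
    quaternionLeft p * quaternionLeft q =
      quaternionLeft (crossProduct p q) - (p ⬝ᵥ q) • (1 : Matrix (Fin 4) (Fin 4) ℝ) := by
  ext i j
  fin_cases i <;> fin_cases j <;>
    simp [quaternionLeft, Matrix.mul_apply, Fin.sum_univ_four, cross_apply, dotProduct,
      Fin.sum_univ_three] <;> ring

theorem quaternionRight_mul (p q : Fin 3 → ℝ) :
    quaternionRight p * quaternionRight q =
      -quaternionRight (crossProduct p q) - (p ⬝ᵥ q) • (1 : Matrix (Fin 4) (Fin 4) ℝ) := by
  ext i j
  fin_cases i <;> fin_cases j <;>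
    simp [quaternionRight, Matrix.mul_apply, Fin.sum_univ_four, cross_apply, dotProduct,
      Fin.sum_univ_three] <;> ring

theorem quaternionLeft_mul_quaternionRight (p q : Fin 3 → ℝ) :
    quaternionLeft p * quaternionRight q = quaternionRight q * quaternionLeft p := by
  ext i j
  fin_cases i <;> fin_cases j <;>
    simp [quaternionLeft, quaternionRight, Matrix.mul_apply, Fin.sum_univ_four] <;> ring

theorem trace_quaternionLeft_mul_quaternionRight (p q : Fin 3 → ℝ) :
    (quaternionLeft p * quaternionRight q).trace = 0 := by
  simp [Matrix.trace, quaternionLeft, quaternionRight, Fin.sum_univ_four]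
  ring

theorem quaternionLeft_dotProduct (p q : Fin 3 → ℝ) (x : Fin 4 → ℝ) :
    (quaternionLeft p *ᵥ x) ⬝ᵥ (quaternionLeft q *ᵥ x) = (p ⬝ᵥ q) * (x ⬝ᵥ x) := by
  simp [quaternionLeft, Matrix.mulVec, dotProduct, Fin.sum_univ_four, Fin.sum_univ_three]
  ring

theorem dotProduct_quaternionLeft (p : Fin 3 → ℝ) (x : Fin 4 → ℝ) :
    x ⬝ᵥ (quaternionLeft p *ᵥ x) = 0 := by
  simp [quaternionLeft, Matrix.mulVec, dotProduct, Fin.sum_univ_four]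
  ring

/-- Right-handed orthonormal triples in three-space. -/
structure IsRightHanded (p : Fin 3 → Fin 3 → ℝ) : Prop where
  orthonormal : ∀ i j, p i ⬝ᵥ p j = if i = j then 1 else 0
  cross : crossProduct (p 0) (p 1) = p 2

variable {p q : Fin 3 → Fin 3 → ℝ}

theorem IsRightHanded.left_sq (hp : IsRightHanded p) (i : Fin 3) :
    quaternionLeft (p i) * quaternionLeft (p i) = -1 := by
  rw [quaternionLeft_mul, hp.orthonormal, cross_self]
  ext a b
  fin_cases a <;> fin_cases b <;> simp [quaternionLeft]

theorem IsRightHanded.right_sq (hq : IsRightHanded q) (i : Fin 3) :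
    quaternionRight (q i) * quaternionRight (q i) = -1 := by
  rw [quaternionRight_mul, hq.orthonormal, cross_self]
  ext a b
  fin_cases a <;> fin_cases b <;> simp [quaternionRight]

theorem IsRightHanded.left_zero_one (hp : IsRightHanded p) :
    quaternionLeft (p 0) * quaternionLeft (p 1) = quaternionLeft (p 2) := by
  rw [quaternionLeft_mul, hp.orthonormal, hp.cross]
  simp

theorem IsRightHanded.left_one_zero (hp : IsRightHanded p) :
    quaternionLeft (p 1) * quaternionLeft (p 0) = -quaternionLeft (p 2) := by
  rw [quaternionLeft_mul, hp.orthonormal, ← cross_anticomm, hp.cross]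
  ext a b
  fin_cases a <;> fin_cases b <;> simp [quaternionLeft]

theorem IsRightHanded.right_zero_one (hq : IsRightHanded q) :
    quaternionRight (q 0) * quaternionRight (q 1) = -quaternionRight (q 2) := by
  rw [quaternionRight_mul, hq.orthonormal, hq.cross]
  simp

theorem IsRightHanded.right_one_zero (hq : IsRightHanded q) :
    quaternionRight (q 1) * quaternionRight (q 0) = quaternionRight (q 2) := by
  rw [quaternionRight_mul, hq.orthonormal, ← cross_anticomm, hq.cross]
  ext a b
  fin_cases a <;> fin_cases b <;> simp [quaternionRight]

/-- Two right-handed triples of imaginary quaternions are conjugate by a unit quaternion. -/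
theorem exists_unit_intertwining (hp : IsRightHanded p) (hq : IsRightHanded q) :
    ∃ e : Fin 4 → ℝ, e ⬝ᵥ e = 1 ∧
      ∀ i, quaternionLeft (p i) *ᵥ e = quaternionRight (q i) *ᵥ e := by
  have ha := hp.left_sq 0
  have hb := hp.left_sq 1
  have hα := hq.right_sq 0
  have hβ := hq.right_sq 1
  have hc := hp.left_zero_one
  have hγ := hq.right_zero_one
  have hγ' := hq.right_one_zero
  have hba := hp.left_one_zero
  have haα := quaternionLeft_mul_quaternionRight (p 0) (q 0)
  have haβ := quaternionLeft_mul_quaternionRight (p 0) (q 1)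
  have hbα := quaternionLeft_mul_quaternionRight (p 1) (q 0)
  have hbβ := quaternionLeft_mul_quaternionRight (p 1) (q 1)
  have t0 := trace_quaternionLeft_mul_quaternionRight (p 0) (q 0)
  have t1 := trace_quaternionLeft_mul_quaternionRight (p 1) (q 1)
  have t2 := trace_quaternionLeft_mul_quaternionRight (p 2) (q 2)
  suffices h : ∃ e : Fin 4 → ℝ, e ≠ 0 ∧
      ∀ i, quaternionLeft (p i) *ᵥ e = quaternionRight (q i) *ᵥ e by
    obtain ⟨e, he, h⟩ := h
    have hpos : 0 < e ⬝ᵥ e := lt_of_le_of_ne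
      (Finset.sum_nonneg fun i _ => mul_self_nonneg (e i))
      fun h => he (dotProduct_self_eq_zero.1 h.symm)
    refine ⟨(√(e ⬝ᵥ e))⁻¹ • e, ?_, fun i => by rw [mulVec_smul, mulVec_smul, h]⟩
    rw [smul_dotProduct, dotProduct_smul, smul_eq_mul, smul_eq_mul, ← mul_assoc, ← mul_inv,
      Real.mul_self_sqrt hpos.le, inv_mul_cancel₀ hpos.ne']
  rw [show (∃ e : Fin 4 → ℝ, e ≠ 0 ∧
      ∀ i, quaternionLeft (p i) *ᵥ e = quaternionRight (q i) *ᵥ e) ↔ ∃ e : Fin 4 → ℝ, e ≠ 0 ∧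
      quaternionLeft (p 0) *ᵥ e = quaternionRight (q 0) *ᵥ e ∧
      quaternionLeft (p 1) *ᵥ e = quaternionRight (q 1) *ᵥ e ∧
      quaternionLeft (p 2) *ᵥ e = quaternionRight (q 2) *ᵥ e by
    simp [Fin.forall_fin_succ]]
  generalize quaternionLeft (p 0) = a, quaternionLeft (p 1) = b, quaternionLeft (p 2) = c,
    quaternionRight (q 0) = α, quaternionRight (q 1) = β, quaternionRight (q 2) = γ at *
  have hP : a * α * (a * α) = 1 := calc
    a * α * (a * α) = a * (α * a) * α := by noncomm_ring
    _ = a * a * (α * α) := by rw [← haα]; noncomm_ring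
    _ = 1 := by rw [ha, hα]; simp
  have hQ : b * β * (b * β) = 1 := calc
    b * β * (b * β) = b * (β * b) * β := by noncomm_ring
    _ = b * b * (β * β) := by rw [← hbβ]; noncomm_ring
    _ = 1 := by rw [hb, hβ]; simp
  have hPQ : a * α * (b * β) = -(c * γ) := calc
    a * α * (b * β) = a * (α * b) * β := by noncomm_ring
    _ = a * b * (α * β) := by rw [← hbα]; noncomm_ring
    _ = -(c * γ) := by rw [hc, hγ]; simp
  have hQP : b * β * (a * α) = -(c * γ) := calc
    b * β * (a * α) = b * (β * a) * α := by noncomm_ring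
    _ = b * a * (β * α) := by rw [← haβ]; noncomm_ring
    _ = -(c * γ) := by rw [hba, hγ']; simp
  -- `P = a α` and `Q = b β` are commuting involutions with `P Q = -(c γ)`, so `N = (1 - P)(1 - Q)`
  -- maps into their common `-1` eigenspace. There `a α x = -x` means `α x = a x`, as `a² = -1`. The
  -- trace 4 shows that `N ≠ 0`.
  obtain ⟨N, hN⟩ : ∃ N, N = 1 - a * α - b * β - c * γ := ⟨_, rfl⟩
  have hPN : a * α * N = -N := by
    have h : N = (1 - a * α) * (1 - b * β) := by
      rw [hN, sub_eq_add_neg _ (c * γ), ← hPQ]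
      noncomm_ring
    rw [h, ← mul_assoc, mul_sub (a * α) 1, hP]
    noncomm_ring
  have hQN : b * β * N = -N := by
    have h : N = (1 - b * β) * (1 - a * α) := by
      rw [hN, sub_eq_add_neg _ (c * γ), ← hQP]
      noncomm_ring
    rw [h, ← mul_assoc, mul_sub (b * β) 1, hQ]
    noncomm_ring
  have h0 : a * N = α * N := by
    have h : a * (a * α * N) = a * a * α * N := by noncomm_ring
    rw [hPN, ha] at h
    simpa using h
  have h1 : b * N = β * N := by
    have h : b * (b * β * N) = b * b * β * N := by noncomm_ring
    rw [hQN, hb] at h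
    simpa using h
  have h2 : c * N = γ * N := by
    rw [← hc, ← hγ', mul_assoc, h1, ← mul_assoc, haβ, mul_assoc, h0, mul_assoc]
  have htr : N.trace = 4 := by
    rw [hN, trace_sub, trace_sub, trace_sub, t0, t1, t2]
    simp
  have hN0 : N ≠ 0 := by
    rintro rfl
    simp at htr
  obtain ⟨x, hx⟩ : ∃ x, N *ᵥ x ≠ 0 := by
    by_contra! h
    exact hN0 (Matrix.ext_of_mulVec_single fun i => by rw [h, zero_mulVec])
  exact ⟨N *ᵥ x, hx, by rw [mulVec_mulVec, h0, ← mulVec_mulVec],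
    by rw [mulVec_mulVec, h1, ← mulVec_mulVec], by rw [mulVec_mulVec, h2, ← mulVec_mulVec]⟩

theorem IsRightHanded.left_zero_two (hp : IsRightHanded p) :
    quaternionLeft (p 0) * quaternionLeft (p 2) = -quaternionLeft (p 1) := by
  rw [← hp.left_zero_one, ← mul_assoc, hp.left_sq, neg_one_mul]

theorem IsRightHanded.left_two_one (hp : IsRightHanded p) :
    quaternionLeft (p 2) * quaternionLeft (p 1) = -quaternionLeft (p 0) := by
  rw [← hp.left_zero_one, mul_assoc, hp.left_sq, mul_neg_one]

theorem IsRightHanded.left_one_two (hp : IsRightHanded p) :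
    quaternionLeft (p 1) * quaternionLeft (p 2) = quaternionLeft (p 0) := by
  rw [← neg_eq_iff_eq_neg.2 hp.left_one_zero, mul_neg, ← mul_assoc, hp.left_sq, neg_one_mul, neg_neg]

theorem IsRightHanded.left_two_zero (hp : IsRightHanded p) :
    quaternionLeft (p 2) * quaternionLeft (p 0) = quaternionLeft (p 1) := by
  rw [← neg_eq_iff_eq_neg.2 hp.left_one_zero, neg_mul, mul_assoc, hp.left_sq, mul_neg_one, neg_neg]

/-- A pair of right-handed triples is induced by a rotation of four-space. -/
theorem exists_orthogonal_conj (hp : IsRightHanded p) (hq : IsRightHanded q) :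
    ∃ U : Matrix (Fin 4) (Fin 4) ℝ, Uᵀ * U = 1 ∧
      (∀ i, quaternionLeft (p i) = U * quaternionLeft (Pi.single i 1) * Uᵀ) ∧
      ∀ i, quaternionRight (q i) = U * quaternionRight (Pi.single i 1) * Uᵀ := by
  obtain ⟨e, he, hpq⟩ := exists_unit_intertwining hp hq
  -- In the frame `e, L(p₀)e, L(p₁)e, L(p₂)e` the operators `L(pᵢ)` follow the standard quaternion
  -- multiplication table.
  let f : Fin 4 → Fin 4 → ℝ := ![e, quaternionLeft (p 0) *ᵥ e,
    quaternionLeft (p 1) *ᵥ e, quaternionLeft (p 2) *ᵥ e]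
  let U : Matrix (Fin 4) (Fin 4) ℝ := (Matrix.of f)ᵀ
  have hU : Uᵀ * U = 1 := by
    ext i j
    rw [Matrix.mul_apply']
    change f i ⬝ᵥ f j = _
    fin_cases i <;> fin_cases j <;>
      simp [f, he, dotProduct_quaternionLeft, quaternionLeft_dotProduct, hp.orthonormal,
        dotProduct_comm _ e]
  have hU' : U * Uᵀ = 1 := mul_eq_one_comm.1 hU
  have hconj : ∀ A B : Matrix (Fin 4) (Fin 4) ℝ,
      (∀ k, A *ᵥ f k = B 0 k • f 0 + B 1 k • f 1 + B 2 k • f 2 + B 3 k • f 3) →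
      A = U * B * Uᵀ := by
    intro A B h
    have h' : A * U = U * B := by
      ext r k
      have hk := congrFun (h k) r
      simp only [Pi.add_apply, Pi.smul_apply, smul_eq_mul] at hk
      rw [Matrix.mul_apply']
      refine hk.trans ?_
      simp only [Matrix.mul_apply, Fin.sum_univ_four, U, Matrix.transpose_apply, Matrix.of_apply]
      ring
    rw [← h', mul_assoc, hU', mul_one]
  -- Left and right multiplications commute and agree on `e`, so `R(qᵢ)` acts on the frame as
  -- standard right multiplication.
  have hmul : ∀ i j, (quaternionRight (q i) * quaternionLeft (p j)) *ᵥ e =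
      (quaternionLeft (p j) * quaternionLeft (p i)) *ᵥ e := by
    intro i j
    rw [← quaternionLeft_mul_quaternionRight, ← mulVec_mulVec, ← hpq, mulVec_mulVec]
  have hL : ∀ i, ∃ v : Fin 3 → ℝ, v = Pi.single i 1 ∧ quaternionLeft (Pi.single i 1) =
      !![0, -v 0, -v 1, -v 2; v 0, 0, -v 2, v 1; v 1, v 2, 0, -v 0; v 2, -v 1, v 0, 0] :=
    fun i => ⟨_, rfl, rfl⟩
  have hR : ∀ i, ∃ v : Fin 3 → ℝ, v = Pi.single i 1 ∧ quaternionRight (Pi.single i 1) =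
      !![0, -v 0, -v 1, -v 2; v 0, 0, v 2, -v 1; v 1, -v 2, 0, v 0; v 2, v 1, -v 0, 0] :=
    fun i => ⟨_, rfl, rfl⟩
  refine ⟨U, hU, fun i => hconj _ _ fun k => ?_, fun i => hconj _ _ fun k => ?_⟩
  · obtain ⟨v, hv, h⟩ := hL i
    rw [h, hv]
    fin_cases i <;> fin_cases k <;>
      simp [f, mulVec_mulVec, hp.left_sq, hp.left_zero_one, hp.left_one_zero, hp.left_zero_two,
        hp.left_two_zero, hp.left_one_two, hp.left_two_one, neg_mulVec]
  · obtain ⟨v, hv, h⟩ := hR i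
    rw [h, hv]
    fin_cases i <;> fin_cases k <;>
      simp [f, hmul, ← hpq, mulVec_mulVec, hp.left_sq, hp.left_zero_one,
        hp.left_one_zero, hp.left_zero_two, hp.left_two_zero, hp.left_one_two, hp.left_two_one,
        neg_mulVec]

end Quaternion

/-! ### Diagonalizing the three blocks by right-handed triples. -/

section Diagonalization
open Matrix

/-- The cross product of the first two vectors is plus or minus the third, so only the third sign
needs adjusting. -/
theorem exists_isRightHanded_smul {p : Fin 3 → Fin 3 → ℝ}
    (hp : ∀ i j, p i ⬝ᵥ p j = if i = j then 1 else 0) :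
    ∃ σ : Fin 3 → ℝ, (∀ i, σ i * σ i = 1) ∧ IsRightHanded fun i => σ i • p i := by
  obtain ⟨w, hw⟩ : ∃ w, w = crossProduct (p 0) (p 1) := ⟨_, rfl⟩
  have h0 : p 0 ⬝ᵥ w = 0 := by rw [hw, dot_self_cross]
  have h1 : p 1 ⬝ᵥ w = 0 := by rw [hw, dot_cross_self]
  have hww : w ⬝ᵥ w = 1 := by
    rw [hw, cross_dot_cross]
    simp [hp]
  have hP : (Matrix.of p)ᵀ * Matrix.of p = 1 := by
    refine mul_eq_one_comm.1 ?_
    ext i j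
    rw [Matrix.mul_apply']
    exact (hp i j).trans (Matrix.one_apply).symm
  have hws : w = (p 2 ⬝ᵥ w) • p 2 := by
    have h : w = (Matrix.of p)ᵀ *ᵥ (Matrix.of p *ᵥ w) := by rw [mulVec_mulVec, hP, one_mulVec]
    have e0 : (Matrix.of p *ᵥ w) 0 = 0 := h0
    have e1 : (Matrix.of p *ᵥ w) 1 = 0 := h1
    have e2 : (Matrix.of p *ᵥ w) 2 = p 2 ⬝ᵥ w := rfl
    generalize Matrix.of p *ᵥ w = x at h e0 e1 e2
    ext j
    refine (congrFun h j).trans ?_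
    simp [Matrix.mulVec, dotProduct, Fin.sum_univ_three, e0, e1, e2, mul_comm]
  have hs : (p 2 ⬝ᵥ w) * (p 2 ⬝ᵥ w) = 1 := by
    have h := hww
    rw [hws] at h
    simpa [smul_dotProduct, dotProduct_smul, hp] using h
  have hσ : ∀ i, (![1, 1, p 2 ⬝ᵥ w] : Fin 3 → ℝ) i * (![1, 1, p 2 ⬝ᵥ w] : Fin 3 → ℝ) i = 1 := by
    intro i
    fin_cases i <;> simp [hs]
  refine ⟨![1, 1, p 2 ⬝ᵥ w], hσ, ⟨fun i j => ?_, ?_⟩⟩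
  · rw [smul_dotProduct, dotProduct_smul, hp, smul_eq_mul, smul_eq_mul, ← mul_assoc]
    split_ifs with h
    · rw [h, hσ, one_mul]
    · simp
  · simpa [← hw] using hws

/-- The singular value decomposition is applied to `A`, `-C` and `Z`. Correcting orientations only
multiplies the singular values by signs, and evaluating `A Z = -(Z C)` on a singular vector gives
`(aᵢ + cᵢ) zᵢ = 0`. -/
theorem exists_isRightHanded_diagonal {A C Z : Matrix (Fin 3) (Fin 3) ℝ} (hA : Aᵀ = A)
    (hC : Cᵀ = C) (hAZ : A * Z = -(Z * C)) :
    ∃ (p q : Fin 3 → Fin 3 → ℝ) (a c z : Fin 3 → ℝ), IsRightHanded p ∧ IsRightHanded q ∧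
      ∀ i, A *ᵥ p i = a i • p i ∧ C *ᵥ q i = c i • q i ∧ Z *ᵥ q i = z i • p i ∧
        (a i + c i) * z i = 0 := by
  have hsymm : ∀ B : Matrix (Fin 3) (Fin 3) ℝ, Bᵀ = B → B.toEuclideanLin.IsSymmetric :=
    fun B hB => isSymmetric_toEuclideanLin_iff.2 hB
  have hC' : (-C)ᵀ = -C := by rw [transpose_neg, hC]
  obtain ⟨u, v, a, c, z, hu, hv, h⟩ := exists_orthonormal_singular_bases (n := 3)
    (E := EuclideanSpace ℝ (Fin 3)) (F := EuclideanSpace ℝ (Fin 3)) (by simp) (by simp)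
    (A := A.toEuclideanLin) (C := (-C).toEuclideanLin) (Z := Z.toEuclideanLin)
    (W := Zᵀ.toEuclideanLin) (hsymm A hA) (hsymm (-C) hC')
    (fun y x => by
      simp [EuclideanSpace.inner_eq_star_dotProduct, Matrix.toLpLin_apply, Matrix.dotProduct_mulVec,
        Matrix.mulVec_transpose])
    (fun y => by
      simp [Matrix.toLpLin_apply, hAZ, mulVec_mulVec, neg_mulVec, mulVec_neg])
  have horth : ∀ w : Fin 3 → EuclideanSpace ℝ (Fin 3), Orthonormal ℝ w →
      ∀ i j, (w i).ofLp ⬝ᵥ (w j).ofLp = if i = j then 1 else 0 := by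
    intro w hw i j
    rw [← orthonormal_iff_ite.1 hw i j, EuclideanSpace.inner_eq_star_dotProduct, star_trivial,
      dotProduct_comm]
  obtain ⟨σ, hσ, hp⟩ := exists_isRightHanded_smul (horth u hu)
  obtain ⟨τ, hτ, hq⟩ := exists_isRightHanded_smul (horth v hv)
  refine ⟨_, _, a, fun i => -c i, fun i => σ i * τ i * z i, hp, hq, fun i => ?_⟩
  have hAu : A *ᵥ (u i).ofLp = a i • (u i).ofLp := congrArg WithLp.ofLp (h i).1
  have hCv : (-C) *ᵥ (v i).ofLp = c i • (v i).ofLp := congrArg WithLp.ofLp (h i).2.1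
  have hZv : Z *ᵥ (v i).ofLp = z i • (u i).ofLp := congrArg WithLp.ofLp (h i).2.2
  refine ⟨?_, ?_, ?_, ?_⟩
  · rw [mulVec_smul, hAu, smul_comm]
  · rw [neg_mulVec, neg_eq_iff_eq_neg] at hCv
    rw [mulVec_smul, hCv, neg_smul, smul_neg, smul_comm]
  · rw [mulVec_smul, hZv, smul_smul, smul_smul]
    congr 1
    linear_combination (-(τ i * z i)) * hσ i
  · have hu0 : (u i).ofLp ⬝ᵥ (u i).ofLp = 1 := by simpa using horth u hu i i
    have key : A *ᵥ (Z *ᵥ (v i).ofLp) = Z *ᵥ ((-C) *ᵥ (v i).ofLp) := by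
      rw [mulVec_mulVec, mulVec_mulVec, hAZ, mul_neg]
    rw [hZv, hCv, mulVec_smul, mulVec_smul, hAu, hZv] at key
    have key' := congrArg (fun x => (u i).ofLp ⬝ᵥ x) key
    simp only [dotProduct_smul, hu0, smul_eq_mul, mul_one] at key'
    linear_combination (σ i * τ i) * key'

end Diagonalization

/-! ### Change of frame. -/

section Transform
open Matrix

theorem Finset.sum_comm_pair {ι κ : Type*} [Fintype ι] [Fintype κ] (f : ι → ι → κ → κ → ℝ) :
    ∑ i, ∑ j, ∑ a, ∑ b, f i j a b = ∑ a, ∑ b, ∑ i, ∑ j, f i j a b := calc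
  _ = ∑ i, ∑ a, ∑ j, ∑ b, f i j a b := Finset.sum_congr rfl fun _ _ => Finset.sum_comm
  _ = ∑ a, ∑ i, ∑ b, ∑ j, f i j a b := by
    rw [Finset.sum_comm]
    exact Finset.sum_congr rfl fun _ _ => Finset.sum_congr rfl fun _ _ => Finset.sum_comm
  _ = _ := Finset.sum_congr rfl fun _ _ => Finset.sum_comm

/-- Components of a tensor in the frame given by the columns of `U`. -/
def tensorTransform {n : ℕ} (T : Fin n → Fin n → Fin n → Fin n → ℝ) (U : Matrix (Fin n) (Fin n) ℝ)
    (a b c d : Fin n) : ℝ :=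
  ∑ i, ∑ j, ∑ k, ∑ l, T i j k l * U i a * U j b * U k c * U l d

theorem IsAlgebraicCurvature.tensorTransform {n : ℕ} {T : Fin n → Fin n → Fin n → Fin n → ℝ}
    (hT : IsAlgebraicCurvature T) (U : Matrix (Fin n) (Fin n) ℝ) :
    IsAlgebraicCurvature (tensorTransform T U) where
  antisymm_left a b c d := by
    unfold _root_.tensorTransform
    rw [Finset.sum_comm]
    simp only [← Finset.sum_neg_distrib]
    refine Finset.sum_congr rfl fun i _ => Finset.sum_congr rfl fun j _ =>
      Finset.sum_congr rfl fun k _ => Finset.sum_congr rfl fun l _ => ?_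
    rw [hT.antisymm_left]
    ring
  antisymm_right a b c d := by
    unfold _root_.tensorTransform
    simp only [← Finset.sum_neg_distrib]
    refine Finset.sum_congr rfl fun i _ => Finset.sum_congr rfl fun j _ => ?_
    rw [Finset.sum_comm]
    refine Finset.sum_congr rfl fun k _ => Finset.sum_congr rfl fun l _ => ?_
    rw [hT.antisymm_right]
    ring
  bianchi a b c d := by
    have h1 : _root_.tensorTransform T U b c a d =
        ∑ i, ∑ j, ∑ k, ∑ l, T j k i l * U i a * U j b * U k c * U l d := by
      unfold _root_.tensorTransform
      refine ((Finset.sum_congr rfl fun _ _ => Finset.sum_comm).trans Finset.sum_comm).trans ?_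
      refine Finset.sum_congr rfl fun i _ => Finset.sum_congr rfl fun j _ =>
        Finset.sum_congr rfl fun k _ => Finset.sum_congr rfl fun l _ => by ring
    have h2 : _root_.tensorTransform T U c a b d =
        ∑ i, ∑ j, ∑ k, ∑ l, T k i j l * U i a * U j b * U k c * U l d := by
      unfold _root_.tensorTransform
      rw [Finset.sum_comm]
      refine Finset.sum_congr rfl fun i _ => ?_
      rw [Finset.sum_comm]
      refine Finset.sum_congr rfl fun j _ => Finset.sum_congr rfl fun k _ =>
        Finset.sum_congr rfl fun l _ => by ring
    rw [h1, h2]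
    unfold _root_.tensorTransform
    simp only [← Finset.sum_add_distrib]
    refine Finset.sum_eq_zero fun i _ => Finset.sum_eq_zero fun j _ =>
      Finset.sum_eq_zero fun k _ => Finset.sum_eq_zero fun l _ => ?_
    linear_combination (U i a * U j b * U k c * U l d) * hT.bianchi i j k l

theorem sum_mul_conj_apply {n : ℕ} (f : Fin n → Fin n → ℝ) (U X : Matrix (Fin n) (Fin n) ℝ) :
    ∑ i, ∑ j, f i j * (U * X * Uᵀ) i j = ∑ a, ∑ b, (∑ i, ∑ j, f i j * U i a * U j b) * X a b := by
  simp only [Matrix.mul_apply, Finset.sum_mul, Finset.mul_sum, Matrix.transpose_apply]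
  rw [← Finset.sum_comm_pair fun i j a b => f i j * U i a * U j b * X a b]
  refine Finset.sum_congr rfl fun i _ => Finset.sum_congr rfl fun j _ => ?_
  rw [Finset.sum_comm]
  refine Finset.sum_congr rfl fun a _ => Finset.sum_congr rfl fun b _ => by ring

/-- Used to read the blocks in the rotated frame off the form in the original one. -/
theorem bivectorForm_conj (T : Fin 4 → Fin 4 → Fin 4 → Fin 4 → ℝ)
    (U X Y : Matrix (Fin 4) (Fin 4) ℝ) :
    bivectorForm T (U * X * Uᵀ) (U * Y * Uᵀ) = bivectorForm (tensorTransform T U) X Y := by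
  unfold bivectorForm
  simp_rw [sum_mul_conj_apply]
  have h1 : ∀ i j : Fin 4, ∑ a, ∑ b, (∑ k, ∑ l, T i j k l * (U * X * Uᵀ) i j * U k a * U l b) * Y a b
      = (∑ a, ∑ b, (∑ k, ∑ l, T i j k l * U k a * U l b) * Y a b) * (U * X * Uᵀ) i j := by
    intro i j
    simp only [Finset.sum_mul]
    refine Finset.sum_congr rfl fun a _ => Finset.sum_congr rfl fun b _ =>
      Finset.sum_congr rfl fun k _ => Finset.sum_congr rfl fun l _ => by ring
  simp_rw [h1, sum_mul_conj_apply]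
  refine Finset.sum_congr rfl fun a _ => Finset.sum_congr rfl fun b _ => ?_
  simp only [Finset.sum_mul, tensorTransform]
  rw [Finset.sum_comm_pair]
  refine Finset.sum_congr rfl fun c _ => Finset.sum_congr rfl fun d _ =>
    Finset.sum_congr rfl fun i _ => Finset.sum_congr rfl fun j _ =>
      Finset.sum_congr rfl fun k _ => Finset.sum_congr rfl fun l _ => by ring

end Transform

/-! ### The generalized Singer–Thorpe frame of a weakly Einstein tensor. -/

section Algebraic
open Matrix
variable {T : Fin 4 → Fin 4 → Fin 4 → Fin 4 → ℝ}

/-- For `i ≠ j` the sign combinations of the blocks, with pair symmetry, separate their four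
summands, so each one vanishes; these include all `R_{ijjk}` with `i ≠ k`. -/
theorem isGeneralizedSingerThorpeTensor_of_blocks (hT : IsAlgebraicCurvature T) {a c z : Fin 3 → ℝ}
    (hA : ∀ i j, curvatureBlock T 1 1 i j = if i = j then a i else 0)
    (hZ : ∀ i j, curvatureBlock T 1 (-1) i j = if i = j then z i else 0)
    (hC : ∀ i j, curvatureBlock T (-1) (-1) i j = if i = j then c i else 0)
    (hacz : ∀ i, (a i + c i) * z i = 0) : IsGeneralizedSingerThorpeTensor T := by
  have hsq : ∀ i, T 0 (![1, 2, 3] i) 0 (![1, 2, 3] i) ^ 2 =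
      T (![2, 3, 1] i) (![3, 1, 2] i) (![2, 3, 1] i) (![3, 1, 2] i) ^ 2 := by
    intro i
    have h1 := hA i i
    have h2 := hZ i i
    have h3 := hC i i
    have h4 := hT.pair_symm 0 (![1, 2, 3] i) (![2, 3, 1] i) (![3, 1, 2] i)
    simp only [curvatureBlock, Matrix.of_apply, if_true] at h1 h2 h3
    rw [h4] at h1 h2 h3
    generalize T 0 (![1, 2, 3] i) 0 (![1, 2, 3] i) = x at h1 h2 h3 ⊢
    generalize T (![2, 3, 1] i) (![3, 1, 2] i) (![2, 3, 1] i) (![3, 1, 2] i) = y at h1 h2 h3 ⊢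
    -- With `w` the mixed component, the blocks read `x + 2w + y`, `x - y` and `x - 2w + y`.
    linear_combination (x + y) * h2 + z i / 2 * (h1 + h3) + 1 / 2 * hacz i
  have hsq0 := hsq 0
  have hsq1 := hsq 1
  have hsq2 := hsq 2
  simp [hT.sort_indices] at hsq0 hsq1 hsq2
  simp [Fin.forall_fin_succ, curvatureBlock, hT.sort_indices, hT.sort_pairs] at hA hZ hC
  refine ⟨fun i j k hik => ?_, ?_, ?_, ?_⟩
  · fin_cases i <;> fin_cases j <;> fin_cases k <;>
      first
      | exact absurd rfl hik
      | simp [hT.sort_indices, hT.sort_pairs] <;> linarith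
  · simpa using hsq0
  · simpa using hsq1
  · simpa using hsq2

/-- In dimension four, a weakly Einstein curvature tensor has generalized Singer-Thorpe components
in a suitable orthonormal frame. -/
theorem IsAlgebraicCurvature.exists_isGeneralizedSingerThorpeTensor (hT : IsAlgebraicCurvature T)
    (hW : IsWeaklyEinsteinTensor T) :
    ∃ U : Matrix (Fin 4) (Fin 4) ℝ, Uᵀ * U = 1 ∧
      IsGeneralizedSingerThorpeTensor (_root_.tensorTransform T U) := by
  obtain ⟨p, q, a, c, z, hp, hq, h⟩ := exists_isRightHanded_diagonal
    (curvatureBlock_transpose hT 1) (curvatureBlock_transpose hT (-1))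
    (curvatureBlock_anticommute hT hW)
  obtain ⟨U, hU, hL, hR⟩ := exists_orthogonal_conj hp hq
  have hT' := hT.tensorTransform U
  refine ⟨U, hU, isGeneralizedSingerThorpeTensor_of_blocks hT' (a := a) (c := c) (z := z)
    (fun i j => ?_) (fun i j => ?_) (fun i j => ?_) fun i => (h i).2.2.2⟩
  · have h1 := bivectorForm_left_left hT' (Pi.single i 1) (Pi.single j 1)
    rw [← bivectorForm_conj, ← hL, ← hL, bivectorForm_left_left hT, (h j).1, dotProduct_smul,
      hp.orthonormal] at h1
    simp at h1
    split_ifs at h1 ⊢ with hij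
    · rw [hij] at h1 ⊢
      linarith
    · linarith
  · have h1 := bivectorForm_left_right hT' (Pi.single i 1) (Pi.single j 1)
    rw [← bivectorForm_conj, ← hL, ← hR, bivectorForm_left_right hT, (h j).2.2.1, dotProduct_smul,
      hp.orthonormal] at h1
    simp at h1
    split_ifs at h1 ⊢ with hij
    · rw [hij] at h1 ⊢
      linarith
    · linarith
  · have h1 := bivectorForm_right_right hT' (Pi.single i 1) (Pi.single j 1)
    rw [← bivectorForm_conj, ← hR, ← hR, bivectorForm_right_right hT, (h j).2.1, dotProduct_smul,
      hq.orthonormal] at h1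
    simp at h1
    split_ifs at h1 ⊢ with hij
    · rw [hij] at h1 ⊢
      linarith
    · linarith

end Algebraic

/-! ### Metric contractions computed in a frame. -/

section FrameContraction
open Matrix

theorem sum_frame_mul_frame {ι κ : Type*} [Fintype ι] [Fintype κ] (F : ι → κ → ℝ) (f h : ι → ℝ) :
    ∑ x, (∑ i, f i * F i x) * (∑ j, h j * F j x) = ∑ j, ∑ i, (∑ x, F j x * F i x) * f i * h j := by
  simp_rw [Finset.sum_mul_sum, Finset.sum_mul]
  rw [Finset.sum_comm]
  refine (Finset.sum_congr rfl fun _ _ => Finset.sum_comm).trans (Finset.sum_comm.trans ?_)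
  exact Finset.sum_congr rfl fun i _ => Finset.sum_congr rfl fun j _ =>
    Finset.sum_congr rfl fun x _ => by ring

theorem sum_contraction_comm {ι κ : Type*} [Fintype ι] [Fintype κ] (W : ι → ι → ℝ) (r : ι → κ → ℝ)
    (a b : κ → ℝ) :
    ∑ J, ∑ I, W J I * (∑ i, a i * r I i) * (∑ j, b j * r J j) =
      ∑ i, ∑ j, a i * b j * ∑ J, (∑ I, W J I * r I i) * r J j := by
  have h1 : ∀ J I, W J I * (∑ i, a i * r I i) * (∑ j, b j * r J j) =
      ∑ i, ∑ j, W J I * (a i * r I i) * (b j * r J j) := by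
    intro J I
    rw [mul_assoc, Finset.sum_mul_sum, Finset.mul_sum]
    refine Finset.sum_congr rfl fun i _ => ?_
    rw [Finset.mul_sum]
    exact Finset.sum_congr rfl fun j _ => by ring
  simp_rw [h1]
  rw [Finset.sum_comm_pair]
  simp_rw [Finset.sum_mul, Finset.mul_sum]
  exact Finset.sum_congr rfl fun i _ => Finset.sum_congr rfl fun j _ =>
    Finset.sum_congr rfl fun J _ => Finset.sum_congr rfl fun I _ => by ring

theorem sum_prod_mul_mul {κ : Type*} [Fintype κ] (f₁ f₂ f₃ : κ → ℝ) :
    ∑ P : κ × κ × κ, f₁ P.1 * f₂ P.2.1 * f₃ P.2.2 = (∑ x, f₁ x) * (∑ x, f₂ x) * ∑ x, f₃ x := by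
  simp only [Fintype.sum_prod_type, mul_assoc, ← Finset.mul_sum, ← Finset.sum_mul]

theorem sum_prod_mul_mul_mul {κ : Type*} [Fintype κ] (f₁ f₂ f₃ f₄ : κ → ℝ) :
    ∑ P : κ × κ × κ × κ, f₁ P.1 * f₂ P.2.1 * f₃ P.2.2.1 * f₄ P.2.2.2 =
      (∑ x, f₁ x) * (∑ x, f₂ x) * (∑ x, f₃ x) * ∑ x, f₄ x := by
  simp only [Fintype.sum_prod_type, mul_assoc, ← Finset.mul_sum, ← Finset.sum_mul]

/-- Contraction of a tensor with the inverse metric `F Fᵀ`, computed in the frame given by the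
columns of `F`. -/
theorem tensorSquare_tensorTransform {n : ℕ} (R : Fin n → Fin n → Fin n → Fin n → ℝ)
    (F : Matrix (Fin n) (Fin n) ℝ) (x y : Fin n) :
    tensorSquare (tensorTransform R F) x y = ∑ i, ∑ j, F i x * F j y * ∑ a, ∑ b, ∑ c,
      (∑ a', ∑ b', ∑ c', (F * Fᵀ) a a' * (F * Fᵀ) b b' * (F * Fᵀ) c c' * R a' b' c' i) *
        R a b c j := by
  -- `K` is the third Kronecker power of `F`, so `K Kᵀ` supplies the three inverse metrics raising
  -- indices.
  let K : Fin n × Fin n × Fin n → Fin n × Fin n × Fin n → ℝ :=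
    fun I P => F I.1 P.1 * F I.2.1 P.2.1 * F I.2.2 P.2.2
  have hK : ∀ I J : Fin n × Fin n × Fin n, ∑ P, K I P * K J P =
      (F * Fᵀ) I.1 J.1 * (F * Fᵀ) I.2.1 J.2.1 * (F * Fᵀ) I.2.2 J.2.2 := by
    intro I J
    simp only [Matrix.mul_apply, Matrix.transpose_apply]
    rw [← sum_prod_mul_mul]
    exact Finset.sum_congr rfl fun P _ => by simp only [K]; ring
  have hT : ∀ (P : Fin n × Fin n × Fin n) (x : Fin n), tensorTransform R F P.1 P.2.1 P.2.2 x =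
      ∑ I : Fin n × Fin n × Fin n, (∑ i, F i x * R I.1 I.2.1 I.2.2 i) * K I P := by
    intro P x
    simp only [tensorTransform, K, Fintype.sum_prod_type, Finset.sum_mul]
    refine Finset.sum_congr rfl fun a _ => Finset.sum_congr rfl fun b _ =>
      Finset.sum_congr rfl fun c _ => Finset.sum_congr rfl fun i _ => by ring
  have h1 : tensorSquare (tensorTransform R F) x y = ∑ P : Fin n × Fin n × Fin n,
      tensorTransform R F P.1 P.2.1 P.2.2 x * tensorTransform R F P.1 P.2.1 P.2.2 y := by
    simp only [tensorSquare, Fintype.sum_prod_type]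
  have h2 : ∀ i j, (∑ a, ∑ b, ∑ c, (∑ a', ∑ b', ∑ c',
      (F * Fᵀ) a a' * (F * Fᵀ) b b' * (F * Fᵀ) c c' * R a' b' c' i) * R a b c j) =
      ∑ J : Fin n × Fin n × Fin n, (∑ I : Fin n × Fin n × Fin n,
        (∑ P, K J P * K I P) * R I.1 I.2.1 I.2.2 i) * R J.1 J.2.1 J.2.2 j := by
    intro i j
    simp only [hK]
    simp only [Fintype.sum_prod_type]
  simp only [h1, h2, hT]
  rw [sum_frame_mul_frame, sum_contraction_comm (fun J I => ∑ P, K J P * K I P)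
    (fun I i => R I.1 I.2.1 I.2.2 i)]

theorem tensorTransform_tensorTransform {n : ℕ} (R : Fin n → Fin n → Fin n → Fin n → ℝ)
    (F U : Matrix (Fin n) (Fin n) ℝ) :
    tensorTransform (tensorTransform R F) U = tensorTransform R (F * U) := by
  -- The fourth Kronecker power is multiplicative, which reduces the claim to associativity.
  let K : Matrix (Fin n) (Fin n) ℝ → Matrix (Fin n × Fin n × Fin n × Fin n)
      (Fin n × Fin n × Fin n × Fin n) ℝ :=
    fun A => Matrix.of fun I P => A I.1 P.1 * A I.2.1 P.2.1 * A I.2.2.1 P.2.2.1 * A I.2.2.2 P.2.2.2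
  have hK : K F * K U = K (F * U) := by
    ext I Q
    simp only [K, Matrix.mul_apply, Matrix.of_apply]
    rw [← sum_prod_mul_mul_mul]
    exact Finset.sum_congr rfl fun P _ => by ring
  have hT : ∀ T A a b c d, tensorTransform T A a b c d =
      ((fun I : Fin n × Fin n × Fin n × Fin n => T I.1 I.2.1 I.2.2.1 I.2.2.2) ᵥ* K A)
        (a, b, c, d) := by
    intro T A a b c d
    simp only [tensorTransform, Matrix.vecMul, dotProduct, K, Matrix.of_apply,
      Fintype.sum_prod_type, mul_assoc]
  ext a b c d
  rw [hT, hT, ← hK, ← vecMul_vecMul]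
  congr 2
  ext I
  exact hT R F _ _ _ _

end FrameContraction

/-! ### From chart components to orthonormal frames. -/

namespace RiemannianCurvature
open Matrix
variable {n : ℕ} {M : Type*} [TopologicalSpace M] [ChartedSpace (EuclideanSpace ℝ (Fin n)) M]
  [IsManifold (𝓡 n) ∞ M]

theorem isAlgebraicCurvature_curvatureCoord (g : Metric n M) (p : M) :
    IsAlgebraicCurvature (curvatureCoord g p) :=
  ⟨curvatureCoord_antisymm_left g p, curvatureCoord_antisymm_right g p,
    curvatureCoord_bianchi g p⟩

/-- The matrix whose columns are the components of the vectors `e a`. -/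
def frameMatrix {p : M} (e : Fin n → TangentSpace (𝓡 n) p) : Matrix (Fin n) (Fin n) ℝ :=
  Matrix.of fun i a => component (e a) i

theorem inner_frame (g : Metric n M) (p : M) (e : Fin n → TangentSpace (𝓡 n) p) (a b : Fin n) :
    g.inner p (e a) (e b) = ((frameMatrix e)ᵀ * metricMatrix g p (extChartAt (𝓡 n) p p) *
      frameMatrix e) a b := by
  rw [inner_eq_sum_component]
  simp only [Matrix.mul_apply, frameMatrix, Matrix.of_apply, Matrix.transpose_apply,
    Finset.sum_mul]
  rw [Finset.sum_comm]
  exact Finset.sum_congr rfl fun i _ => Finset.sum_congr rfl fun j _ => by ring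

variable {g : Metric n M} {p : M} {F : Matrix (Fin n) (Fin n) ℝ}

theorem tensorSquare_frame (hF : Fᵀ * metricMatrix g p (extChartAt (𝓡 n) p p) * F = 1) :
    Matrix.of (tensorSquare (tensorTransform (curvatureCoord g p) F)) =
      Fᵀ * Matrix.of (curvatureSquare g p) * F := by
  have hinv : (metricMatrix g p (extChartAt (𝓡 n) p p))⁻¹ = F * Fᵀ := by
    refine inv_eq_left_inv ?_
    rw [mul_assoc]
    exact mul_eq_one_comm.1 hF
  ext x y
  rw [Matrix.of_apply, tensorSquare_tensorTransform, ← hinv]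
  have h : ∀ i j, curvatureSquare g p i j = Matrix.of (curvatureSquare g p) i j := fun _ _ => rfl
  change ∑ i, ∑ j, F i x * F j y * curvatureSquare g p i j = _
  simp only [Matrix.mul_apply, Matrix.transpose_apply, h, Finset.sum_mul]
  rw [Finset.sum_comm]
  exact Finset.sum_congr rfl fun j _ => Finset.sum_congr rfl fun i _ => by ring

theorem curvatureNormSq_frame (hF : Fᵀ * metricMatrix g p (extChartAt (𝓡 n) p p) * F = 1) :
    curvatureNormSq g p =
      ∑ k, tensorSquare (tensorTransform (curvatureCoord g p) F) k k := by
  have hinv : (metricMatrix g p (extChartAt (𝓡 n) p p))⁻¹ = F * Fᵀ := by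
    refine inv_eq_left_inv ?_
    rw [mul_assoc]
    exact mul_eq_one_comm.1 hF
  have h : ∑ k, tensorSquare (tensorTransform (curvatureCoord g p) F) k k =
      (Fᵀ * Matrix.of (curvatureSquare g p) * F).trace := by
    rw [← tensorSquare_frame hF]
    rfl
  rw [h, Matrix.trace_mul_comm, ← mul_assoc]
  simp only [curvatureNormSq, Matrix.trace, Matrix.diag_apply]
  rw [Finset.sum_comm]
  refine Finset.sum_congr rfl fun j _ => ?_
  rw [Matrix.mul_apply]
  refine Finset.sum_congr rfl fun i _ => ?_
  rw [hinv, ← Matrix.transpose_apply (F * Fᵀ), Matrix.transpose_mul, Matrix.transpose_transpose,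
    Matrix.of_apply]

/-- In the frame the condition is `Fᵀ Ř F = λ 1`; as `Fᵀ G F = 1` and `F` is invertible, this is
congruent to `Ř = λ G`. -/
theorem isWeaklyEinsteinTensor_frame_iff
    (hF : Fᵀ * metricMatrix g p (extChartAt (𝓡 n) p p) * F = 1) :
    IsWeaklyEinsteinTensor (tensorTransform (curvatureCoord g p) F) ↔
      ∀ i j, curvatureSquare g p i j =
        (1 / n) * curvatureNormSq g p * metricMatrix g p (extChartAt (𝓡 n) p p) i j := by
  set G := metricMatrix g p (extChartAt (𝓡 n) p p) with hG
  have h1 : G * F * Fᵀ = 1 := mul_eq_one_comm.1 (by rw [← mul_assoc, hF])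
  have h2 : F * (Fᵀ * G) = 1 := mul_eq_one_comm.1 hF
  have hS : IsWeaklyEinsteinTensor (tensorTransform (curvatureCoord g p) F) ↔
      Fᵀ * Matrix.of (curvatureSquare g p) * F = ((1 / n : ℝ) * curvatureNormSq g p) • 1 := by
    rw [← tensorSquare_frame hF, ← Matrix.ext_iff, curvatureNormSq_frame hF]
    simp [IsWeaklyEinsteinTensor, Matrix.one_apply]
  have hR : (∀ i j, curvatureSquare g p i j = (1 / n) * curvatureNormSq g p * G i j) ↔
      Matrix.of (curvatureSquare g p) = ((1 / n : ℝ) * curvatureNormSq g p) • G := by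
    rw [← Matrix.ext_iff]
    simp
  rw [hS, hR]
  constructor
  · intro h
    calc Matrix.of (curvatureSquare g p)
        = G * F * Fᵀ * Matrix.of (curvatureSquare g p) * (F * (Fᵀ * G)) := by rw [h1, h2]; simp
      _ = G * F * (Fᵀ * Matrix.of (curvatureSquare g p) * F) * (Fᵀ * G) := by
        simp only [mul_assoc]
      _ = ((1 / n : ℝ) * curvatureNormSq g p) • (G * F * Fᵀ * G) := by
        rw [h]
        simp [mul_assoc]
      _ = _ := by rw [h1, one_mul]
  · intro h
    rw [h, Matrix.mul_smul, Matrix.smul_mul, hF]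

/-- Factor the positive definite metric as `Bᵀ B` and take `F = B⁻¹`. -/
theorem exists_frame (g : Metric n M) (p : M) :
    ∃ F : Matrix (Fin n) (Fin n) ℝ, Fᵀ * metricMatrix g p (extChartAt (𝓡 n) p p) * F = 1 := by
  have hpos := metricMatrix_posDef g p
  have hdet := det_metricMatrix_self_ne_zero g p
  obtain ⟨B, hB⟩ : ∃ B : Matrix (Fin n) (Fin n) ℝ,
      metricMatrix g p (extChartAt (𝓡 n) p p) = Bᵀ * B := by
    open scoped MatrixOrder Matrix.Norms.L2Operator in
    obtain ⟨B, hB⟩ := CStarAlgebra.nonneg_iff_eq_star_mul_self.mp hpos.posSemidef.nonneg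
    exact ⟨B, hB⟩
  rw [hB] at hdet ⊢
  have hBdet : IsUnit B.det := by
    rw [det_mul] at hdet
    exact isUnit_iff_ne_zero.2 (right_ne_zero_of_mul hdet)
  refine ⟨B⁻¹, ?_⟩
  rw [mul_assoc, mul_assoc, mul_nonsing_inv _ hBdet, mul_one, ← transpose_mul,
    mul_nonsing_inv _ hBdet, transpose_one]

/-- The frame with prescribed components. -/
theorem exists_frameMatrix_eq (p : M) (F : Matrix (Fin n) (Fin n) ℝ) :
    ∃ e : Fin n → TangentSpace (𝓡 n) p, frameMatrix e = F := by
  refine ⟨fun a => (WithLp.toLp 2 (fun i => F i a) : EuclideanSpace ℝ (Fin n)), ?_⟩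
  ext i a
  exact component_eq _ i

theorem linearIndependent_of_orthonormal {e : Fin n → TangentSpace (𝓡 n) p}
    (he : ∀ i j, g.inner p (e i) (e j) = if i = j then 1 else 0) : LinearIndependent ℝ e := by
  rw [Fintype.linearIndependent_iff]
  intro c hc j
  have h := congrArg (fun v => g.inner p v (e j)) hc
  simpa [he] using h

end RiemannianCurvature

/-! ### The equivalence at a point. -/

open RiemannianCurvature in
-- The curvature on frame vectors is by definition `tensorTransform` of the chart components by
-- `frameMatrix`, so only the fields are regrouped.
theorem isGeneralizedSingerThorpeBasis_iff {M : Type*} [TopologicalSpace M]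
    [ChartedSpace (EuclideanSpace ℝ (Fin 4)) M] [IsManifold (𝓡 4) ∞ M] (g : Metric 4 M) (p : M)
    (e : Module.Basis (Fin 4) ℝ (TangentSpace (𝓡 4) p)) :
    IsGeneralizedSingerThorpeBasis g p e ↔
      (∀ i j, g.inner p (e i) (e j) = if i = j then 1 else 0) ∧
      IsGeneralizedSingerThorpeTensor (tensorTransform (curvatureCoord g p) (frameMatrix e)) :=
  ⟨fun h => ⟨h.orthonormal, h.offDiagonal, h.sq_12_34, h.sq_13_24, h.sq_14_23⟩,
    fun h => ⟨h.1, h.2.offDiagonal, h.2.sq_12_34, h.2.sq_13_24, h.2.sq_14_23⟩⟩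

open RiemannianCurvature in
theorem isWeaklyEinstein_at_iff {M : Type*} [TopologicalSpace M]
    [ChartedSpace (EuclideanSpace ℝ (Fin 4)) M] [IsManifold (𝓡 4) ∞ M] (g : Metric 4 M) (p : M) :
    (∀ i j, curvatureSquare g p i j =
        (1 / 4) * curvatureNormSq g p * metricMatrix g p (extChartAt (𝓡 4) p p) i j) ↔
      ∃ e : Module.Basis (Fin 4) ℝ (TangentSpace (𝓡 4) p),
        IsGeneralizedSingerThorpeBasis g p e := by
  have hR := isAlgebraicCurvature_curvatureCoord g p
  constructor
  · intro hW
    obtain ⟨F, hF⟩ := exists_frame g p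
    have hWF := (isWeaklyEinsteinTensor_frame_iff hF).2 hW
    obtain ⟨U, hU, hST⟩ := (hR.tensorTransform F).exists_isGeneralizedSingerThorpeTensor hWF
    rw [tensorTransform_tensorTransform] at hST
    obtain ⟨e, he⟩ := exists_frameMatrix_eq p (F * U)
    have horth : ∀ i j, g.inner p (e i) (e j) = if i = j then 1 else 0 := by
      intro i j
      have h : (F * U).transpose * metricMatrix g p (extChartAt (𝓡 4) p p) * (F * U) = 1 := calc
        _ = U.transpose * (F.transpose * metricMatrix g p (extChartAt (𝓡 4) p p) * F) * U := by
          simp only [Matrix.transpose_mul, Matrix.mul_assoc]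
        _ = 1 := by rw [hF, Matrix.mul_one, hU]
      rw [inner_frame, he, h, Matrix.one_apply]
    have : FiniteDimensional ℝ (TangentSpace (𝓡 4) p) :=
      inferInstanceAs (FiniteDimensional ℝ (EuclideanSpace ℝ (Fin 4)))
    have hcard : Fintype.card (Fin 4) = Module.finrank ℝ (TangentSpace (𝓡 4) p) :=
      (finrank_euclideanSpace (𝕜 := ℝ) (ι := Fin 4)).symm
    refine ⟨basisOfLinearIndependentOfCardEqFinrank (linearIndependent_of_orthonormal horth) hcard,
      (isGeneralizedSingerThorpeBasis_iff g p _).2 ?_⟩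
    rw [coe_basisOfLinearIndependentOfCardEqFinrank, he]
    exact ⟨horth, hST⟩
  · rintro ⟨e, he⟩
    obtain ⟨horth, hST⟩ := (isGeneralizedSingerThorpeBasis_iff g p e).1 he
    refine (isWeaklyEinsteinTensor_frame_iff ?_).1
      (hST.isWeaklyEinsteinTensor (hR.tensorTransform (frameMatrix e)))
    ext i j
    rw [← inner_frame, horth, Matrix.one_apply]

end

/-- A 4-dimensional Riemannian manifold is weakly Einstein if and only if every tangent space has a
generalized Singer-Thorpe basis. -/
theorem theoremB {M : Type*} [TopologicalSpace M]
    [ChartedSpace (EuclideanSpace ℝ (Fin 4)) M] [IsManifold (𝓡 4) ∞ M]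
    (g : RiemannianCurvature.Metric 4 M) :
    IsWeaklyEinstein g ↔
      ∀ p : M, ∃ e : Module.Basis (Fin 4) ℝ (TangentSpace (𝓡 4) p),
        IsGeneralizedSingerThorpeBasis g p e :=
  forall_congr' fun p => isWeaklyEinstein_at_iff g p
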